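/- \textbf{Groups.} A \emph{Banach homogeneous group} is a real Banach space $\mathbb M$ with a continuous bilinear, skew-symmetric bracket satisfying the Jacobi identity, and closed subspaces $H_1,\dots,H_\nu$ with $\mathbb M=H_1\oplus\cdots\oplus H_\nu$, $[H_i,H_j]\subset H_{i+j}$ if $i+j\le\nu$ and $[H_i,H_j]=\{0\}$ otherwise; it carries the group operation $xy=x+y+\sum_{m=2}^{\nu}P_m(x,y)$, where $\sum_m P_m$ is the Baker--Campbell--Hausdorff series in Dynkin's form (so the identity is $0$ and $x^{-1}=-x$). Write $\pi_i:\mathbb M\to H_i$ for the projections and $\delta_r x=\sum_i r^i\pi_i(x)$, $r>0$, for the dilations. A \emph{Banach homogeneous norm} is a function $\|x\|=\max_{1\le i\le\nu}\sigma_i|\pi_i(x)|^{1/i}$ with $\sigma_i>0$, $\sigma_1=1$, such that $\|xy\|\le\|x\|+\|y\|$ for all $x,y$; its distance is $\rho(x,y)=\|x^{-1}y\|$. A \emph{stratified group} $\mathbb G=V_1\oplus\cdots\oplus V_s$ is a finite-dimensional Banach homogeneous group with $[V_1,V_j]=V_{j+1}$ for $j\ge1$, where $V_j=\{0\}$ for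 $j>s$. A \emph{homogeneous distance} on $\mathbb G$ is a distance $d$ with $d(zx,zy)=d(x,y)$ and $d(\delta_rx,\delta_ry)=r\,d(x,y)$ for all $x,y,z\in\mathbb G$, $r>0$; $B(x,r)$ denotes its open balls. \textbf{Density points, directional derivatives, porosity.} Let $\mu$ be a Haar measure on $\mathbb G$. A point $x$ is a \emph{density point} of $A\subset\mathbb G$ if $\mu(A\cap B(x,r))/\mu(B(x,r))\to1$ as $r\downarrow0$. Points $\zeta^t\in\mathbb G$, $t>0$, \emph{approximate in $A$ the direction $\zeta\in\mathbb G$ at $x$} if $x\zeta^t\in A$ for every $t>0$ and $d(\zeta^t,\delta_t\zeta)/t\to0$ as $t\downarrow0$. For $f:A\to\mathbb M$, $x\in A$ and $\zeta\in\mathbb G$ (the value $\zeta=0$ is allowed), $\partial^+f(x,\zeta)$ \emph{exists and equals} $w\in\mathbb M$ if the direction $\zeta$ can be approximated in $A$ at $x$ and, for every choice of points $\zeta^t$ approximating in $A$ the direction $\zeta$ at $x$, \[\lim_{t\downarrow0}\delta_{1/t}\big(f(x)^{-1}f(x\zeta^t)\big)=w.\] A set $E\subset\mathbb G$ is \emph{porous}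 if there is $\Lambda>0$ such that for every $a\in E$ there are points $x_n\ne a$ with $x_n\to a$ and $B(x_n,\Lambda d(a,x_n))\cap E=\emptyset$ for every $n$; a set is \emph{$\sigma$-porous} if it is a countable union of porous sets. \textbf{Theorem.} Let $\mathbb G$ be a stratified group with a homogeneous distance $d$ and a Haar measure $\mu$, let $\mathbb M$ be a Banach homogeneous group with a Banach homogeneous norm and its distance $\rho$, let $A\subset\mathbb G$ be $\mu$-measurable, and let $f:A\to\mathbb M$ be Lipschitz from $d$ to $\rho$. Then there is a $\sigma$-porous set $P\subset\mathbb G$ such that for every density point $x$ of $A$ with $x\in A\setminus P$ and all $\zeta,\eta\in\mathbb G$ the following holds: if $\partial^+f(x,\zeta)$ and $\partial^+f(x,\eta)$ exist, then for all $a,b>0$ the derivative $\partial^+f(x,\delta_a\zeta\,\delta_b\eta)$ exists and \[\partial^+f(x,\delta_a\zeta\,\delta_b\eta)=\delta_a\partial^+f(x,\zeta)\,\delta_b\partial^+f(x,\eta).\] -/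

import Mathlib

open Filter Topology MeasureTheory

/-- A Banach homogeneous group whose underlying space is `M` (the completeness of `M` is a separate
hypothesis wherever it is needed): a continuous Lie bracket on `M` together with a stratification
`M = H₁ ⊕ ⋯ ⊕ H_ν` into closed subspaces with `[H_i, H_j] ⊆ H_{i+j}`, where `H_k = {0}` for
`k > ν`.  The Lie algebra is then nilpotent of step at most `ν`; the group operation is
`BanachHomogeneousGroup.mul`. -/
structure BanachHomogeneousGroup (M : Type*) [NormedAddCommGroup M] [NormedSpace ℝ M] where
  /-- The Lie bracket, a continuous bilinear map. -/
  bracket : M →L[ℝ] M →L[ℝ] M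
  skew : ∀ x y, bracket x y = -bracket y x
  jacobi : ∀ x y z,
    bracket x (bracket y z) + bracket y (bracket z x) + bracket z (bracket x y) = 0
  /-- The number `ν` of layers. -/
  step : ℕ
  /-- The layers; only the indices `1, …, ν` carry information. -/
  layer : ℕ → Submodule ℝ M
  layer_eq_bot : ∀ i, i = 0 ∨ step < i → layer i = ⊥
  isClosed_layer : ∀ i, IsClosed (layer i : Set M)
  /-- The layers form a direct sum: `(s_i)_i ↦ ∑ s_i` is a bijection. -/
  bijective_sum : Function.Bijective (DirectSum.coeLinearMap layer)
  bracket_mem : ∀ i j x y, x ∈ layer i → y ∈ layer j → bracket x y ∈ layer (i + j)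

namespace BanachHomogeneousGroup

variable {M : Type*} [NormedAddCommGroup M] [NormedSpace ℝ M] (H : BanachHomogeneousGroup M)

/-- The canonical projection `π_i : M → H_i`, with values regarded as elements of `M`. -/
noncomputable def proj (i : ℕ) (x : M) : M :=
  ((LinearEquiv.ofBijective (DirectSum.coeLinearMap H.layer) H.bijective_sum).symm x i : M)

/-- The dilation `δ_r`, acting as multiplication by `r ^ i` on the layer `H_i`. -/
noncomputable def dil (r : ℝ) (x : M) : M :=
  ∑ i ∈ Finset.Icc 1 H.step, r ^ i • H.proj i x

/-- The iterated bracket `[[⋯[[x₁, x₂], x₃]⋯], x_k]` of a list of vectors. -/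
noncomputable def iterBracket : List M → M
  | [] => 0
  | a :: l => l.foldl (fun u v => H.bracket u v) a

/-- The index set of the `k`-block part of the degree `m` term of Dynkin's formula: all
`(p₁, q₁), …, (p_k, q_k)` with `p_i + q_i ≥ 1` and `∑ (p_i + q_i) = m`. -/
def dynkinIndex (m k : ℕ) : Finset (Fin k → ℕ × ℕ) :=
  (Fintype.piFinset fun _ : Fin k => Finset.range (m + 1) ×ˢ Finset.range (m + 1)).filter
    fun c => (∀ i, 1 ≤ (c i).1 + (c i).2) ∧ ∑ i, ((c i).1 + (c i).2) = m

/-- The homogeneous polynomial `P_m(x, y)` of the Baker-Campbell-Hausdorff series, given by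
Dynkin's formula (the blocks are nonempty, so at most `m` of them occur). -/
noncomputable def dynkinPoly (m : ℕ) (x y : M) : M :=
  ∑ k ∈ Finset.Icc 1 m, ∑ c ∈ dynkinIndex m k,
    ((-1 : ℝ) ^ (k - 1) / k *
        ((m : ℝ)⁻¹ / ∏ i, (((c i).1.factorial : ℝ) * ((c i).2.factorial : ℝ)))) •
      H.iterBracket
        (List.ofFn fun i => List.replicate (c i).1 x ++ List.replicate (c i).2 y).flatten

/-- The group operation: the truncated Baker-Campbell-Hausdorff series. -/
noncomputable def mul (x y : M) : M :=
  x + y + ∑ m ∈ Finset.Icc 2 H.step, H.dynkinPoly m x y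

/-- The group inverse, which in these coordinates is `-x`; see `mul_inv_self`. The identity
element is `0`. -/
def inv (_H : BanachHomogeneousGroup M) (x : M) : M := -x

/-- The function `‖x‖ = max {σ_i |π_i(x)|^{1/i} : 1 ≤ i ≤ ν}`. -/
noncomputable def homNorm (σ : ℕ → ℝ) (x : M) : ℝ :=
  ⨆ i : Fin H.step, σ (i + 1) * ‖H.proj (i + 1) x‖ ^ (1 / ((i : ℝ) + 1))

/-- A Banach homogeneous norm: positive weights `σ_1 = 1, σ_2, …, σ_ν` for which the function
`homNorm` is subadditive for the group operation. -/
structure HomogeneousNorm where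
  /-- The weights; only the indices `1, …, ν` matter. -/
  σ : ℕ → ℝ
  σ_one : σ 1 = 1
  σ_pos : ∀ i, 1 ≤ i → i ≤ H.step → 0 < σ i
  homNorm_mul_le : ∀ x y, H.homNorm σ (H.mul x y) ≤ H.homNorm σ x + H.homNorm σ y

/-- The Banach homogeneous distance `ρ(x, y) = ‖x⁻¹ y‖`. -/
noncomputable def HomogeneousNorm.dist {H : BanachHomogeneousGroup M} (N : H.HomogeneousNorm)
    (x y : M) : ℝ :=
  H.homNorm N.σ (H.mul (H.inv x) y)

/-- A homogeneous distance: a distance on the set `M` which is left invariant and scales under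
dilations. -/
structure HomogeneousDistance where
  /-- The distance function. -/
  d : M → M → ℝ
  eq_zero_iff : ∀ x y, d x y = 0 ↔ x = y
  symm : ∀ x y, d x y = d y x
  triangle : ∀ x y z, d x z ≤ d x y + d y z
  mul_left : ∀ z x y, d (H.mul z x) (H.mul z y) = d x y
  dil : ∀ r : ℝ, 0 < r → ∀ x y, d (H.dil r x) (H.dil r y) = r * d x y

/-- The open ball of a homogeneous distance. -/
def HomogeneousDistance.ball {H : BanachHomogeneousGroup M} (D : H.HomogeneousDistance)
    (x : M) (r : ℝ) : Set M :=
  {y | D.d x y < r}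

/-- A stratified group: a finite dimensional Banach homogeneous group whose first layer satisfies
`[H₁, H_j] = H_{j+1}` for all `j ≥ 1` (the linear span of the brackets). -/
structure IsStratified : Prop where
  finiteDimensional : FiniteDimensional ℝ M
  span_bracket : ∀ j, 1 ≤ j →
    Submodule.span ℝ {z | ∃ x ∈ H.layer 1, ∃ y ∈ H.layer j, H.bracket x y = z} = H.layer (j + 1)

/-- A (left) Haar measure for the group operation. -/
structure IsHaar [MeasurableSpace M] (μ : Measure M) : Prop where
  finite_on_compacts : IsFiniteMeasureOnCompacts μ
  open_pos : μ.IsOpenPosMeasure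
  map_mul_left : ∀ x, μ.map (H.mul x) = μ

/-- `A` is porous for the distance `D`: there is one constant `c > 0` such that every `a ∈ A` is the
limit of points `x_n ≠ a` with `B(x_n, c * d(a, x_n)) ∩ A = ∅`. -/
def IsPorous {H : BanachHomogeneousGroup M} (D : H.HomogeneousDistance) (A : Set M) : Prop :=
  ∃ c : ℝ, 0 < c ∧ ∀ a ∈ A, ∃ x : ℕ → M, (∀ n, x n ≠ a) ∧
    Tendsto (fun n => D.d a (x n)) atTop (𝓝 0) ∧
    ∀ n, D.ball (x n) (c * D.d a (x n)) ∩ A = ∅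

/-- A countable union of porous sets. -/
def IsSigmaPorous {H : BanachHomogeneousGroup M} (D : H.HomogeneousDistance) (A : Set M) : Prop :=
  ∃ S : ℕ → Set M, (∀ n, IsPorous D (S n)) ∧ A = ⋃ n, S n

/-- `x` is a density point of `A`. -/
def IsDensityPoint {H : BanachHomogeneousGroup M} (D : H.HomogeneousDistance) [MeasurableSpace M]
    (μ : Measure M) (A : Set M) (x : M) : Prop :=
  Tendsto (fun r : ℝ => μ (A ∩ D.ball x r) / μ (D.ball x r)) (𝓝[>] 0) (𝓝 1)

/-- The points `p t`, `t > 0`, approximate in `A` the direction `ζ` at `x`. -/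
def Approximates {H : BanachHomogeneousGroup M} (D : H.HomogeneousDistance) (A : Set M) (x ζ : M)
    (p : ℝ → M) : Prop :=
  (∀ t, 0 < t → H.mul x (p t) ∈ A) ∧
    Tendsto (fun t : ℝ => D.d (p t) (H.dil t ζ) / t) (𝓝[>] 0) (𝓝 0)

/-- `w` is the directional derivative `∂⁺f(x, ζ)` of `f : A → M` (only the values of `f` on `A`
matter): `x ∈ A`, the direction `ζ` can be approximated in `A` at `x`, and along every choice of
approximating points `p t` one has `δ_{1/t}(f(x)⁻¹ f(x p_t)) → w` for the distance of the target.
The direction `ζ = 0` is allowed. -/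
def HasDirDeriv {E : Type*} [NormedAddCommGroup E] [NormedSpace ℝ E]
    {G : BanachHomogeneousGroup E} (D : G.HomogeneousDistance)
    {H : BanachHomogeneousGroup M} (N : H.HomogeneousNorm)
    (A : Set E) (f : E → M) (x ζ : E) (w : M) : Prop :=
  x ∈ A ∧ (∃ p, Approximates D A x ζ p) ∧
    ∀ p, Approximates D A x ζ p →
      Tendsto
        (fun t : ℝ => N.dist (H.dil (1 / t) (H.mul (H.inv (f x)) (f (G.mul x (p t))))) w)
        (𝓝[>] 0) (𝓝 0)

/-- `f` is Lipschitz on `A`. -/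
def IsLipschitzOn {E : Type*} [NormedAddCommGroup E] [NormedSpace ℝ E]
    {G : BanachHomogeneousGroup E} (D : G.HomogeneousDistance)
    {H : BanachHomogeneousGroup M} (N : H.HomogeneousNorm) (A : Set E) (f : E → M) : Prop :=
  ∃ K : ℝ, ∀ x ∈ A, ∀ y ∈ A, N.dist (f x) (f y) ≤ K * D.d x y

theorem bracket_self (x : M) : H.bracket x x = 0 := by
  have h : (2 : ℝ) • H.bracket x x = 0 := by
    rw [two_smul]
    nth_rewrite 1 [H.skew x x]
    simp
  simpa using h

theorem iterBracket_eq_zero (x : M) (l : List M) (hl : ∀ a ∈ l, a = x ∨ a = -x)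
    (h2 : 2 ≤ l.length) : H.iterBracket l = 0 := by
  match l with
  | [] => simp at h2
  | [_] => simp at h2
  | a :: b :: l =>
    have hab : H.bracket a b = 0 := by
      rcases hl a (by simp) with rfl | rfl <;> rcases hl b (by simp) with h | h <;>
        simp [h, H.bracket_self]
    have h0 : ∀ l : List M, l.foldl (fun u v => H.bracket u v) 0 = 0 := by
      intro l
      induction l with
      | nil => rfl
      | cons c l ih => simpa using ih
    simp [iterBracket, hab, h0]

theorem mul_inv_self (x : M) : H.mul x (H.inv x) = 0 := by
  have hP : ∀ m ∈ Finset.Icc 2 H.step, H.dynkinPoly m x (-x) = 0 := by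
    intro m hm
    refine Finset.sum_eq_zero fun k _ => Finset.sum_eq_zero fun c hc => ?_
    rw [H.iterBracket_eq_zero x, smul_zero]
    · intro a ha
      simp only [List.mem_flatten, List.mem_ofFn] at ha
      obtain ⟨l, ⟨i, rfl⟩, hl⟩ := ha
      rcases List.mem_append.mp hl with h | h
      · exact Or.inl (List.eq_of_mem_replicate h)
      · exact Or.inr (List.eq_of_mem_replicate h)
    · have hs := (Finset.mem_filter.mp hc).2.2
      have h2 := (Finset.mem_Icc.mp hm).1
      simp only [List.length_flatten, List.map_ofFn, List.sum_ofFn, Function.comp_def,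
        List.length_append, List.length_replicate]
      omega
  simp [mul, inv, Finset.sum_eq_zero hP]

end BanachHomogeneousGroup

/-!
Additivity of directional derivatives of Lipschitz maps into Banach homogeneous groups, outside a
`σ`-porous set.

Suppose that `f` has the directional derivatives `w` and `v` at `x` in the directions `ζ` and `η`.
To find the increment of `f` from `x` to `x p_t ≈ x δ_t ζ δ_t η`, one passes through a point `z` of
`A` with `z ≈ x δ_t ζ`.  The increment from `x` to `z` is close to `δ_t w`, but the derivative of
`f` at `x` says nothing about increments starting at `z`.  Therefore one considers, for countably
many `(η', v')` and scales, the set `stableSet` of the points at which the increment in the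
direction `η'` is `v'` up to an `ε`-error at all small scales; the exceptional set is the union of
the sets of points at which one of these sets is porous.  If `x` lies in a stable set and is not a
porosity point of it, then a point `z` of the same stable set can be chosen at a distance from
`x δ_t ζ` which is an arbitrarily small multiple of `t`, and the increment from `z` to
`x p_t` is close to `δ_t v`: this is `HasDirDeriv.mul`.
Countably many pairs are enough because `A`, hence the set of rescaled increments of `f`, is
separable (`isSeparable_increments`).  That the direction `ζ η` can be approximated in `A` follows
from the density of `A` at `x`, by covering a ball with finitely many small balls and dilating
(`exists_approximates`).

The argument needs the group laws, and a comparison of the topologies.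

* Associativity of the operation defined by Dynkin's formula (`mul_assoc'`) is deduced from the
  Baker-Campbell-Hausdorff formula in an associative algebra of nilpotent operators.  The Lie
  algebra `M`, extended by its grading derivation, acts faithfully on `M × ℝ`, since the derivation
  is injective.  The logarithm of `e ^ (t y) e ^ (t x)` has Lie coefficients (`coeff_truncLog_mem`),
  as its derivative in `t` satisfies a recursion in terms of commutators.  A second action of `M`
  on `M × ℝ`, in which an element `w` of degree `m` sends `(0, 1)` to `(m w, 0)`, turns words
  applied to `(0, 1)` into iterated brackets, which identifies the coefficient of degree `m` as
  Dynkin's polynomial (`truncExp_rep_mul`).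
* A homogeneous distance on a stratified group induces the norm topology (`tendsto_gauge_zero`,
  `exists_norm_lt`).  The distance from the identity is bounded on bounded sets, since every layer
  is spanned by iterated brackets of vectors of the first layer, and brackets are the leading terms
  of group commutators.
* The distance of a Banach homogeneous norm also induces the norm topology, because the projections
  onto the layers are continuous; hence right translations are continuous for it
  (`exists_dist_mul_right_lt`).
-/

/-! ### Exponentials and logarithms of nilpotent elements -/

section NilpotentExp

variable {B : Type*} [Ring B] [Algebra ℝ B]

/-- The exponential series truncated after degree `N`; it is the full exponential on elements `b`
with `b ^ (N + 1) = 0`. -/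
noncomputable def truncExp (N : ℕ) (b : B) : B :=
  ∑ i ∈ Finset.range (N + 1), ((i.factorial : ℝ)⁻¹) • b ^ i

/-- The series of `log b` in powers of `b - 1`, truncated after degree `N`. -/
noncomputable def truncLog (N : ℕ) (b : B) : B :=
  ∑ k ∈ Finset.Icc 1 N, ((-1 : ℝ) ^ (k - 1) / k) • (b - 1) ^ k

theorem map_truncExp {C : Type*} [Ring C] [Algebra ℝ C] (φ : B →ₐ[ℝ] C) (N : ℕ) (b : B) :
    φ (truncExp N b) = truncExp N (φ b) := by
  simp [truncExp, map_sum]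

theorem map_truncLog {C : Type*} [Ring C] [Algebra ℝ C] (φ : B →ₐ[ℝ] C) (N : ℕ) (b : B) :
    φ (truncLog N b) = truncLog N (φ b) := by
  simp [truncLog, map_sum]

open Polynomial in
theorem derivative_truncExp (N : ℕ) (p : ℝ[X]) :
    derivative (truncExp (N + 1) p) = truncExp N p * derivative p := by
  rw [truncExp, Finset.sum_range_succ']
  simp only [truncExp, map_add, map_sum, derivative_smul, derivative_pow, pow_zero,
    derivative_one, smul_zero, add_zero, Finset.sum_mul]
  refine Finset.sum_congr rfl fun i _ => ?_
  rw [← smul_mul_assoc, ← smul_eq_C_mul, smul_smul, Nat.factorial_succ, Nat.add_sub_cancel]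
  congr 2
  have : (i.factorial : ℝ) ≠ 0 := by positivity
  push_cast
  field_simp

open Polynomial in
/-- The derivative of the truncated logarithm series is a truncated geometric series. -/
theorem derivative_truncLog_mul (N : ℕ) (p : ℝ[X]) :
    derivative (truncLog N p) * p = (1 - (1 - p) ^ N) * derivative p := by
  have h1 : derivative (truncLog N p) = (∑ k ∈ Finset.range N, (1 - p) ^ k) * derivative p := by
    have : Finset.Icc 1 N = Finset.Ico 1 (N + 1) := by ext; simp
    rw [truncLog, map_sum, Finset.sum_mul, this, Finset.sum_Ico_eq_sum_range, Nat.add_sub_cancel]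
    refine Finset.sum_congr rfl fun k _ => ?_
    rw [derivative_smul, derivative_pow, derivative_sub, derivative_one, sub_zero,
      smul_eq_C_mul, ← mul_assoc, ← mul_assoc, ← C_mul]
    have hk0 : ((1 + k : ℕ) : ℝ) ≠ 0 := by positivity
    rw [div_mul_cancel₀ _ hk0, Nat.add_sub_cancel_left]
    congr 1
    rw [← neg_sub p 1, neg_pow (p - 1), C_pow, C_neg, C_1]
  have h2 := geom_sum_mul_neg (1 - p) N
  rw [sub_sub_cancel] at h2
  rw [h1, mul_right_comm, h2]

open Polynomial in
theorem X_pow_succ_dvd_of_derivative {p : ℝ[X]} {N : ℕ} (h0 : p.coeff 0 = 0)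
    (h : X ^ N ∣ derivative p) : X ^ (N + 1) ∣ p := by
  rw [X_pow_dvd_iff] at h ⊢
  intro d hd
  cases d with
  | zero => exact h0
  | succ d =>
    have := h d (by omega)
    rw [coeff_derivative] at this
    exact (mul_eq_zero.mp this).resolve_right (by positivity)

open Polynomial in
theorem X_dvd_truncExp_sub_one (N : ℕ) : (X : ℝ[X]) ∣ truncExp N X - 1 := by
  rw [truncExp, Finset.sum_range_succ']
  simp only [pow_zero, Nat.factorial_zero, Nat.cast_one, inv_one, one_smul, add_sub_cancel_right]
  exact Finset.dvd_sum fun i _ => dvd_smul_of_dvd _ (dvd_pow_self _ (by simp))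

open Polynomial in
/-- The formal identity `log (e ^ X) = X`, modulo `X ^ (N + 1)`: both sides have the same
derivative. -/
theorem truncLog_truncExp_X (N : ℕ) :
    (X : ℝ[X]) ^ (N + 1) ∣ truncLog N (truncExp N X) - X := by
  obtain rfl | hN := Nat.eq_zero_or_pos N
  · simp [truncLog]
  obtain ⟨n, rfl⟩ : ∃ n, N = n + 1 := ⟨N - 1, by omega⟩
  set e : ℝ[X] := truncExp (n + 1) X with he
  have hX : X ∣ e - 1 := X_dvd_truncExp_sub_one _
  apply X_pow_succ_dvd_of_derivative
  · have : X ∣ truncLog (n + 1) e - X := by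
      refine dvd_sub (Finset.dvd_sum fun k hk => ?_) dvd_rfl
      have := (Finset.mem_Icc.mp hk).1
      exact dvd_smul_of_dvd _ (dvd_pow hX (by omega))
    exact X_dvd_iff.mp this
  · have h1 := derivative_truncLog_mul (n + 1) e
    have h2 : derivative e = e - ((n + 1).factorial : ℝ)⁻¹ • X ^ (n + 1) := by
      rw [he, derivative_truncExp, derivative_X, mul_one, eq_sub_iff_add_eq, truncExp, truncExp,
        Finset.sum_range_succ _ (n + 1)]
    have h3 : X ^ (n + 1) ∣ (1 - e) ^ (n + 1) :=
      pow_dvd_pow_of_dvd (by rw [← neg_sub]; exact hX.neg_right) _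
    have h4 : X ^ (n + 1) ∣ (derivative (truncLog (n + 1) e) - 1) * e := by
      rw [sub_mul, h1, one_mul]
      have : (1 - (1 - e) ^ (n + 1)) * derivative e - e =
        (derivative e - e) - (1 - e) ^ (n + 1) * derivative e := by ring
      rw [this]
      refine dvd_sub ?_ (h3.mul_right _)
      rw [h2, sub_sub_cancel_left]
      exact (dvd_smul_of_dvd _ dvd_rfl).neg_right
    have hcop : IsCoprime ((X : ℝ[X]) ^ (n + 1)) e := by
      apply IsCoprime.pow_left
      obtain ⟨q, hq⟩ := hX
      exact ⟨-q, 1, by linear_combination hq⟩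
    have h5 := hcop.dvd_of_dvd_mul_right h4
    simpa using h5

open Polynomial in
/-- The formal identity `e ^ (log (1 + X)) = 1 + X`, modulo `X ^ (N + 1)`: both sides satisfy
`(1 + X) g' = g`, which determines `g` up to a factor. -/
theorem truncExp_truncLog_X (N : ℕ) :
    (X : ℝ[X]) ^ (N + 1) ∣ truncExp N (truncLog N (1 + X)) - (1 + X) := by
  obtain rfl | hN := Nat.eq_zero_or_pos N
  · simp [truncExp]
  obtain ⟨n, rfl⟩ : ∃ n, N = n + 1 := ⟨N - 1, by omega⟩
  set l : ℝ[X] := truncLog (n + 1) (1 + X) with hl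
  have hXl : X ∣ l := by
    refine Finset.dvd_sum fun k hk => ?_
    have := (Finset.mem_Icc.mp hk).1
    rw [add_sub_cancel_left]
    exact dvd_smul_of_dvd _ (dvd_pow_self _ (by omega))
  have hl' : derivative l * (1 + X) = 1 - (-X) ^ (n + 1) := by
    have := derivative_truncLog_mul (n + 1) (1 + X)
    simpa using this
  set g : ℝ[X] := truncExp (n + 1) l with hg
  have hg' : derivative g = derivative l * (g - ((n + 1).factorial : ℝ)⁻¹ • l ^ (n + 1)) := by
    rw [hg, derivative_truncExp, mul_comm, truncExp, truncExp, Finset.sum_range_succ _ (n + 1),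
      add_sub_cancel_right]
  have hdiv : X ^ (n + 1) ∣ (1 + X) * derivative (g - (1 + X)) - (g - (1 + X)) := by
    have : (1 + X) * derivative (g - (1 + X)) - (g - (1 + X)) =
      - (((n + 1).factorial : ℝ)⁻¹ • l ^ (n + 1)) -
        (-X) ^ (n + 1) * (g - ((n + 1).factorial : ℝ)⁻¹ • l ^ (n + 1)) := by
      rw [derivative_sub, hg']
      simp only [derivative_add, derivative_one, derivative_X, zero_add]
      linear_combination (g - ((n + 1).factorial : ℝ)⁻¹ • l ^ (n + 1)) * hl'
    rw [this]
    refine dvd_sub (dvd_smul_of_dvd _ (pow_dvd_pow_of_dvd hXl _)).neg_right ?_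
    rw [neg_pow]
    exact ((dvd_rfl).mul_left _).mul_right _
  have h0 : (g - (1 + X)).coeff 0 = 0 := by
    rw [← X_dvd_iff]
    have : g - (1 + X) = (∑ i ∈ Finset.range (n + 1), ((i + 1).factorial : ℝ)⁻¹ • l ^ (i + 1))
        - X := by
      rw [hg, truncExp, Finset.sum_range_succ']
      simp only [pow_zero, Nat.factorial_zero, Nat.cast_one, inv_one, one_smul]
      ring
    rw [this]
    exact dvd_sub (Finset.dvd_sum fun i _ => dvd_smul_of_dvd _ (dvd_pow hXl (by simp))) dvd_rfl
  rw [X_pow_dvd_iff] at hdiv ⊢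
  intro d
  induction d with
  | zero => exact fun _ => h0
  | succ d ih =>
    intro hd
    have h1 := hdiv d (by omega)
    have h2 := ih (by omega)
    rw [coeff_sub, h2, sub_zero, add_mul, one_mul, coeff_add, coeff_derivative] at h1
    have h3 : (X * derivative (g - (1 + X))).coeff d = 0 := by
      cases d with
      | zero => simp
      | succ d => rw [coeff_X_mul, coeff_derivative, h2, zero_mul]
    rw [h3, add_zero] at h1
    exact (mul_eq_zero.mp h1).resolve_right (by positivity)

theorem truncLog_truncExp {N : ℕ} {b : B} (hb : b ^ (N + 1) = 0) :
    truncLog N (truncExp N b) = b := by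
  obtain ⟨q, hq⟩ := truncLog_truncExp_X N
  have := congrArg (Polynomial.aeval b) hq
  simpa [map_truncLog, map_truncExp, hb, sub_eq_zero] using this

theorem truncExp_truncLog {N : ℕ} {b : B} (hb : (b - 1) ^ (N + 1) = 0) :
    truncExp N (truncLog N b) = b := by
  obtain ⟨q, hq⟩ := truncExp_truncLog_X N
  have := congrArg (Polynomial.aeval (b - 1)) hq
  simpa [map_truncLog, map_truncExp, hb, sub_eq_zero] using this

/-- Summation along antidiagonals of an array supported in a rectangle. -/
theorem sum_antidiagonal_eq_sum_rectangle {C : Type*} [AddCommMonoid C] (f : ℕ → ℕ → C) (n m : ℕ)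
    (hf : ∀ i j, n ≤ i ∨ m ≤ j → f i j = 0) :
    ∑ l ∈ Finset.range (n + m), ∑ p ∈ Finset.HasAntidiagonal.antidiagonal l, f p.1 p.2 =
      ∑ i ∈ Finset.range n, ∑ j ∈ Finset.range m, f i j := by
  rw [← Finset.sum_product', ← Finset.sum_fiberwise_of_maps_to
    (t := Finset.range (n + m)) (g := fun p : ℕ × ℕ => p.1 + p.2)]
  · refine Finset.sum_congr rfl fun l _ => (Finset.sum_subset ?_ ?_).symm
    · intro p hp
      simp only [Finset.mem_filter] at hp
      simpa using hp.2
    · intro p hp hp'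
      apply hf
      by_contra! h
      exact hp' (by simpa [h.1, h.2] using hp)
  · intro p hp
    simp only [Finset.mem_product, Finset.mem_range] at hp ⊢
    omega

/-- The inner derivation `a ↦ a z - z a`. -/
noncomputable def rad (z : B) : Module.End ℝ B :=
  LinearMap.mulRight ℝ z - LinearMap.mulLeft ℝ z

theorem rad_apply (z a : B) : rad z a = a * z - z * a := rfl

theorem mul_pow_eq_sum_rad (z a : B) (n : ℕ) :
    a * z ^ n = ∑ p ∈ Finset.HasAntidiagonal.antidiagonal n,
      (n.choose p.1 : ℝ) • (z ^ p.1 * (rad z ^ p.2) a) := by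
  have hc : Commute (LinearMap.mulLeft ℝ z) (rad z) :=
    ((LinearMap.commute_mulLeft_right (R := ℝ) z z)).sub_right (Commute.refl _)
  have h := congrArg (fun φ : Module.End ℝ B => φ a) (hc.add_pow' n)
  simp only [rad, add_sub_cancel, LinearMap.pow_mulRight, LinearMap.mulRight_apply] at h
  rw [h, LinearMap.sum_apply]
  refine Finset.sum_congr rfl fun p _ => ?_
  rw [LinearMap.smul_apply, LinearMap.pow_mulLeft, Module.End.mul_apply, LinearMap.mulLeft_apply,
    Nat.cast_smul_eq_nsmul]
  rfl

theorem rad_pow_eq_zero {z : B} {N : ℕ} (hz : z ^ (N + 1) = 0) {k : ℕ} (hk : 2 * N + 1 ≤ k) :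
    rad z ^ k = 0 := by
  have hc : Commute (LinearMap.mulRight ℝ z) (-LinearMap.mulLeft ℝ z) :=
    ((LinearMap.commute_mulLeft_right (R := ℝ) z z).symm).neg_right
  rw [rad, sub_eq_add_neg, hc.add_pow']
  refine Finset.sum_eq_zero fun p hp => ?_
  have hp := Finset.HasAntidiagonal.mem_antidiagonal.mp hp
  have hz' : ∀ i, N + 1 ≤ i → z ^ i = 0 := fun i hi => pow_eq_zero_of_le hi hz
  have hneg : (-LinearMap.mulLeft ℝ z : Module.End ℝ B) = LinearMap.mulLeft ℝ (-z) := by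
    ext b
    simp
  rw [hneg, LinearMap.pow_mulRight, LinearMap.pow_mulLeft, neg_pow]
  rcases le_or_gt (N + 1) p.1 with h | h
  · simp [hz' _ h]
  · simp [hz' p.2 (by omega)]

/-- Conjugation by an exponential is the exponential of the inner derivation. -/
theorem mul_truncExp {N : ℕ} {z : B} (hz : z ^ (N + 1) = 0) (a : B) :
    a * truncExp N z = truncExp N z * truncExp (2 * N) (rad z) a := by
  set f : ℕ → ℕ → B := fun i j =>
    ((i.factorial : ℝ)⁻¹ • z ^ i) * ((j.factorial : ℝ)⁻¹ • (rad z ^ j) a) with hf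
  have h := sum_antidiagonal_eq_sum_rectangle f (N + 1) (2 * N + 1) (by
    rintro i j (h | h)
    · simp [hf, pow_eq_zero_of_le h hz]
    · simp [hf, rad_pow_eq_zero hz h])
  have hR : truncExp N z * truncExp (2 * N) (rad z) a =
      ∑ i ∈ Finset.range (N + 1), ∑ j ∈ Finset.range (2 * N + 1), f i j := by
    simp only [truncExp, LinearMap.sum_apply, LinearMap.smul_apply, hf, Finset.sum_mul_sum]
  rw [hR, ← h]
  have hL : truncExp N z = ∑ i ∈ Finset.range ((N + 1) + (2 * N + 1)),
      ((i.factorial : ℝ)⁻¹) • z ^ i := by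
    refine Finset.sum_subset (by intro; simp; omega) fun i _ hi => ?_
    rw [pow_eq_zero_of_le (by simpa using hi) hz, smul_zero]
  rw [hL, Finset.mul_sum]
  refine Finset.sum_congr rfl fun l _ => ?_
  rw [mul_smul_comm, mul_pow_eq_sum_rad, Finset.smul_sum]
  refine Finset.sum_congr rfl fun p hp => ?_
  have hp := Finset.HasAntidiagonal.mem_antidiagonal.mp hp
  simp only [hf, smul_smul, smul_mul_assoc, mul_smul_comm]
  congr 1
  rw [← hp, Nat.choose_symm_add, Nat.add_choose]
  rw [Nat.cast_div (Nat.factorial_mul_factorial_dvd_factorial_add _ _) (by positivity)]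
  have h1 : (p.1.factorial : ℝ) ≠ 0 := by positivity
  have h2 : (p.2.factorial : ℝ) ≠ 0 := by positivity
  have h3 : ((p.1 + p.2).factorial : ℝ) ≠ 0 := by positivity
  push_cast
  field_simp

/-- The derivative of an exponential: `∂ (e^z) = e^z ∑ (rad z)^k (∂z) / (k + 1)!`.  It is
`mul_truncExp` for the operators `∂` and `b ↦ z b`, whose commutator is `b ↦ (∂z) b`. -/
theorem deriv_truncExp (δ : Module.End ℝ B) (hδ : ∀ a b, δ (a * b) = δ a * b + a * δ b)
    {N : ℕ} {z : B} (hz : z ^ (N + 1) = 0) :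
    δ (truncExp N z) = truncExp N z *
      ∑ k ∈ Finset.range (2 * N), (((k + 1).factorial : ℝ)⁻¹) • (rad z ^ k) (δ z) := by
  have h1 : δ 1 = 0 := by simpa using hδ 1 1
  have hL : ∀ n, LinearMap.mulLeft ℝ z ^ n = LinearMap.mulLeft ℝ (z ^ n) :=
    fun n => by simp
  have hexp : truncExp N (LinearMap.mulLeft ℝ z) = LinearMap.mulLeft ℝ (truncExp N z) := by
    ext b
    simp [truncExp, LinearMap.sum_apply, Finset.sum_mul]
  have hrad : ∀ k, ((rad (LinearMap.mulLeft ℝ z)) ^ (k + 1)) δ =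
      LinearMap.mulLeft ℝ ((rad z ^ k) (δ z)) := by
    intro k
    induction k with
    | zero =>
      ext b
      simp [rad_apply, hδ]
    | succ k ih =>
      rw [pow_succ', Module.End.mul_apply, ih, pow_succ', Module.End.mul_apply]
      ext b
      simp [rad_apply, sub_mul, mul_assoc]
  have h := mul_truncExp (N := N) (z := LinearMap.mulLeft ℝ z) (by rw [hL, hz]; simp) δ
  have h' := congrArg (fun φ : Module.End ℝ B => φ 1) h
  simp only [hexp, Module.End.mul_apply, LinearMap.mulLeft_apply, mul_one] at h'
  rw [h']
  congr 1
  rw [truncExp, Finset.sum_range_succ']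
  simp [LinearMap.sum_apply, hrad, h1]

end NilpotentExp

/-! ### The logarithm of a product of exponentials in a graded Lie algebra -/

section GradedLog

open Polynomial

variable {A : Type*} [Ring A] [Algebra ℝ A]

/-- The polynomials `∑ a_m t ^ m` with `a_m ∈ J m`. -/
def gradedPoly (J : ℕ → Submodule ℝ A) : Submodule ℝ A[X] where
  carrier := {p | ∀ m, p.coeff m ∈ J m}
  add_mem' := fun hp hq m => by rw [coeff_add]; exact (J m).add_mem (hp m) (hq m)
  zero_mem' := fun m => by simp
  smul_mem' := fun r p hp m => by rw [coeff_smul]; exact (J m).smul_mem r (hp m)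

theorem monomial_one_mem_gradedPoly {J : ℕ → Submodule ℝ A} {x : A} (hx : x ∈ J 1) :
    monomial 1 x ∈ gradedPoly J := by
  intro m
  rw [coeff_monomial]
  split_ifs with h
  · rwa [← h]
  · exact (J m).zero_mem

/-- A multiplicative family of subspaces `J m` which vanishes in degrees above `N`. -/
structure IsNilGrading (J : ℕ → Submodule ℝ A) (N : ℕ) : Prop where
  one_mem : (1 : A) ∈ J 0
  mul_mem : ∀ m n a b, a ∈ J m → b ∈ J n → a * b ∈ J (m + n)
  eq_zero : ∀ m, N < m → ∀ a ∈ J m, a = 0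

namespace IsNilGrading

variable {J : ℕ → Submodule ℝ A} {N : ℕ} (hJ : IsNilGrading J N)
include hJ

theorem poly_one_mem : (1 : A[X]) ∈ gradedPoly J := by
  intro m
  rw [coeff_one]
  split_ifs with h
  · rw [h]; exact hJ.one_mem
  · exact (J m).zero_mem

theorem poly_mul_mem {p q : A[X]} (hp : p ∈ gradedPoly J) (hq : q ∈ gradedPoly J) :
    p * q ∈ gradedPoly J := by
  intro m
  rw [coeff_mul]
  refine (J m).sum_mem fun i hi => ?_
  rw [← Finset.HasAntidiagonal.mem_antidiagonal.mp hi]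
  exact hJ.mul_mem _ _ _ _ (hp _) (hq _)

theorem poly_pow_mem {p : A[X]} (hp : p ∈ gradedPoly J) (n : ℕ) : p ^ n ∈ gradedPoly J := by
  induction n with
  | zero => rw [pow_zero]; exact hJ.poly_one_mem
  | succ n ih => rw [pow_succ]; exact hJ.poly_mul_mem ih hp

omit [Algebra ℝ A] hJ in
theorem _root_.coeff_pow_eq_zero_of_coeff_zero {p : A[X]} (h0 : p.coeff 0 = 0) (n : ℕ) :
    ∀ m < n, (p ^ n).coeff m = 0 := by
  induction n with
  | zero => intro m hm; omega
  | succ n ih =>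
    intro m hm
    rw [pow_succ, coeff_mul]
    refine Finset.sum_eq_zero fun i hi => ?_
    have hi := Finset.HasAntidiagonal.mem_antidiagonal.mp hi
    rcases Nat.eq_zero_or_pos i.2 with h | h
    · rw [h, h0, mul_zero]
    · rw [ih _ (by omega), zero_mul]

theorem poly_pow_eq_zero {p : A[X]} (hp : p ∈ gradedPoly J) (h0 : p.coeff 0 = 0) :
    p ^ (N + 1) = 0 := by
  ext m
  rcases lt_or_ge N m with h | h
  · exact hJ.eq_zero m h _ (hJ.poly_pow_mem hp _ m)
  · exact coeff_pow_eq_zero_of_coeff_zero h0 _ m (by omega)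

theorem poly_truncExp_mem {p : A[X]} (hp : p ∈ gradedPoly J) :
    truncExp N p ∈ gradedPoly J :=
  Submodule.sum_mem _ fun i _ => Submodule.smul_mem _ _ (hJ.poly_pow_mem hp i)

theorem poly_truncLog_mem {p : A[X]} (hp : p ∈ gradedPoly J) :
    truncLog N p ∈ gradedPoly J :=
  Submodule.sum_mem _ fun i _ => Submodule.smul_mem _ _
    (hJ.poly_pow_mem (Submodule.sub_mem _ hp hJ.poly_one_mem) i)

end IsNilGrading

theorem coeff_zero_truncExp {p : A[X]} (h0 : p.coeff 0 = 0) (N : ℕ) :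
    (truncExp N p).coeff 0 = 1 := by
  rw [truncExp, Finset.sum_range_succ', coeff_add, finsetSum_coeff,
    Finset.sum_eq_zero fun i _ => ?_]
  · simp
  · rw [coeff_smul, coeff_pow_eq_zero_of_coeff_zero h0 _ 0 (by omega), smul_zero]

theorem coeff_zero_truncLog {p : A[X]} (h0 : p.coeff 0 = 1) (N : ℕ) :
    (truncLog N p).coeff 0 = 0 := by
  rw [truncLog, finsetSum_coeff]
  refine Finset.sum_eq_zero fun i hi => ?_
  have := (Finset.mem_Icc.mp hi).1
  rw [coeff_smul, coeff_pow_eq_zero_of_coeff_zero (by simp [h0]) _ 0 (by omega), smul_zero]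

/-- Bracketing with `z = ∑ z_m t ^ m`, where `z_m ∈ g m` for `1 ≤ m ≤ n` and `z_0 = 0`, raises by
one the degree up to which the coefficients of `∑ p_m t ^ m` satisfy `p_m ∈ g (m + 1)`. -/
theorem coeff_rad_mem {g : ℕ → Submodule ℝ A}
    (hg : ∀ m n a b, a ∈ g m → b ∈ g n → a * b - b * a ∈ g (m + n)) {z p : A[X]} {n : ℕ}
    (hz0 : z.coeff 0 = 0) (hz : ∀ m, 1 ≤ m → m ≤ n → z.coeff m ∈ g m)
    (hp : ∀ m, m < n → p.coeff m ∈ g (m + 1)) :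
    ∀ m, m ≤ n → (rad z p).coeff m ∈ g (m + 1) := by
  intro m hm
  have hswap : (z * p).coeff m =
      ∑ i ∈ Finset.HasAntidiagonal.antidiagonal m, z.coeff i.2 * p.coeff i.1 := by
    rw [coeff_mul, ← Finset.Nat.sum_antidiagonal_swap]
    rfl
  rw [rad_apply, coeff_sub, hswap, coeff_mul, ← Finset.sum_sub_distrib]
  refine (g _).sum_mem fun i hi => ?_
  have hi := Finset.HasAntidiagonal.mem_antidiagonal.mp hi
  rcases Nat.eq_zero_or_pos i.2 with h | h
  · simp [h, hz0]
  · have := hg (i.1 + 1) i.2 _ _ (hp i.1 (by omega)) (hz i.2 h (by omega))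
    rwa [show i.1 + 1 + i.2 = m + 1 by omega] at this

/-- The derivation `∂/∂t` of `A[t]`, as a real linear map. -/
noncomputable def realDerivative : Module.End ℝ A[X] where
  toFun := derivative
  map_add' := fun _ _ => derivative_add
  map_smul' := fun r p => by simp

/-- The Baker-Campbell-Hausdorff theorem in its qualitative form: the coefficients of
`log (e ^ (t y) e ^ (t x))` are Lie elements.  With `Z` this logarithm, differentiation gives
`∑ (rad Z) ^ k (Z') / (k + 1)! = ∑ (rad (t x)) ^ k (x + y) / k!`, which determines the
coefficients of `Z'` recursively by Lie brackets. -/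
theorem coeff_truncLog_mem {J g : ℕ → Submodule ℝ A} {N : ℕ} (hJ : IsNilGrading J N)
    (hg : ∀ m n a b, a ∈ g m → b ∈ g n → a * b - b * a ∈ g (m + n)) {x y : A}
    (hxJ : x ∈ J 1) (hyJ : y ∈ J 1) (hx : x ∈ g 1) (hy : y ∈ g 1) (m : ℕ) (hm : 1 ≤ m) :
    (truncLog N (truncExp N (monomial 1 y) * truncExp N (monomial 1 x))).coeff m ∈ g m ∧
      truncExp N (truncLog N (truncExp N (monomial 1 y) * truncExp N (monomial 1 x))) =
        truncExp N (monomial 1 y) * truncExp N (monomial 1 x) := by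
  set X' : A[X] := monomial 1 x with hX'
  set Y' : A[X] := monomial 1 y with hY'
  set W : A[X] := truncExp N Y' * truncExp N X' with hW
  set Z : A[X] := truncLog N W with hZ
  have hX0 : X'.coeff 0 = 0 := by simp [hX', coeff_monomial]
  have hY0 : Y'.coeff 0 = 0 := by simp [hY', coeff_monomial]
  have hXJ := monomial_one_mem_gradedPoly hxJ
  have hYJ := monomial_one_mem_gradedPoly hyJ
  have hXn : X' ^ (N + 1) = 0 := hJ.poly_pow_eq_zero hXJ hX0
  have hYn : Y' ^ (N + 1) = 0 := hJ.poly_pow_eq_zero hYJ hY0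
  have hW0 : W.coeff 0 = 1 := by
    rw [hW, mul_coeff_zero, coeff_zero_truncExp hX0, coeff_zero_truncExp hY0, mul_one]
  have hWJ : W ∈ gradedPoly J :=
    hJ.poly_mul_mem (hJ.poly_truncExp_mem hYJ) (hJ.poly_truncExp_mem hXJ)
  have hWn : (W - 1) ^ (N + 1) = 0 :=
    hJ.poly_pow_eq_zero (Submodule.sub_mem _ hWJ hJ.poly_one_mem) (by simp [hW0])
  have hZ0 : Z.coeff 0 = 0 := coeff_zero_truncLog hW0 N
  have hZn : Z ^ (N + 1) = 0 := hJ.poly_pow_eq_zero (hJ.poly_truncLog_mem hWJ) hZ0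
  have hexp : truncExp N Z = W := truncExp_truncLog hWn
  refine ⟨?_, hexp⟩
  -- the logarithmic derivative of `W`, computed in two ways
  set c : A[X] := truncExp (2 * N) (rad X') (C (x + y)) with hc
  have hd : ∀ a : A[X], realDerivative a = derivative a := fun _ => rfl
  have hδ : ∀ a b : A[X], realDerivative (a * b) = realDerivative a * b + a * realDerivative b :=
    fun a b => derivative_mul
  have hlin : ∀ u : A, (monomial 1 u : A[X]) ^ (N + 1) = 0 →
      realDerivative (truncExp N (monomial 1 u)) = truncExp N (monomial 1 u) * C u := by
    intro u hu
    rw [deriv_truncExp realDerivative hδ hu]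
    have hdu : realDerivative (monomial 1 u : A[X]) = C u := by
      rw [hd]; simp
    have hr : rad (monomial 1 u : A[X]) (C u) = 0 := by
      rw [rad_apply, ← monomial_zero_left, monomial_mul_monomial, monomial_mul_monomial]
      simp
    rw [hdu]
    cases N with
    | zero =>
      have : (monomial 1 u : A[X]) = 0 := by simpa using hu
      have : u = 0 := by simpa using this
      simp [this]
    | succ N =>
      rw [show 2 * (N + 1) = (2 * N + 1) + 1 by ring, Finset.sum_range_succ']
      simp [pow_succ, hr]
  have hWd : realDerivative W = W * c := by
    have hcomm : truncExp N X' * C x = C x * truncExp N X' := by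
      simp only [truncExp, Finset.sum_mul, Finset.mul_sum]
      refine Finset.sum_congr rfl fun i _ => ?_
      have : Commute X' (C x) := by
        rw [Commute, SemiconjBy, hX', ← monomial_zero_left, monomial_mul_monomial,
          monomial_mul_monomial]
      rw [smul_mul_assoc, mul_smul_comm, (this.pow_left i).eq]
    rw [hW, hδ, hlin y hYn, hlin x hXn, hcomm, mul_assoc, ← mul_add, ← add_mul,
      ← C_add, add_comm y x, mul_truncExp hXn, mul_assoc]
  have hZd : ∑ k ∈ Finset.range (2 * N), (((k + 1).factorial : ℝ)⁻¹) •
      (rad Z ^ k) (realDerivative Z) = c := by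
    have hu : IsUnit W := by
      have : IsNilpotent (W - 1) := ⟨_, hWn⟩
      simpa using this.isUnit_one_add
    apply hu.mul_left_cancel
    rw [← hWd, ← hexp, deriv_truncExp realDerivative hδ hZn, hexp]
  have hcg : ∀ i, c.coeff i ∈ g (i + 1) := by
    intro i
    rw [hc, truncExp, LinearMap.sum_apply, finsetSum_coeff]
    refine (g _).sum_mem fun k hk => ?_
    rw [LinearMap.smul_apply, coeff_smul]
    refine (g _).smul_mem _ ?_
    clear hc hk
    induction k generalizing i with
    | zero =>
      rw [pow_zero, Module.End.one_apply, coeff_C]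
      split_ifs with h
      · rw [h]; exact (g _).add_mem hx hy
      · exact (g _).zero_mem
    | succ k ih =>
      rw [pow_succ', Module.End.mul_apply]
      refine coeff_rad_mem hg (n := i) hX0 (fun m hm _ => ?_) (fun m _ => ih m) i le_rfl
      rw [hX', coeff_monomial]
      split_ifs with h
      · rwa [← h]
      · exact (g _).zero_mem
  -- a degenerate case: for `N = 0` the algebra has no elements of positive degree
  obtain rfl | hN := Nat.eq_zero_or_pos N
  · simp [hZ, truncLog]
  obtain ⟨n, hn⟩ : ∃ n, 2 * N = n + 1 := ⟨2 * N - 1, by omega⟩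
  rw [hn, Finset.sum_range_succ'] at hZd
  simp only [zero_add, Nat.factorial_one, Nat.cast_one, inv_one, pow_zero, Module.End.one_apply,
    one_smul] at hZd
  induction m using Nat.strong_induction_on with
  | _ m ih =>
  obtain ⟨m, rfl⟩ : ∃ m', m = m' + 1 := ⟨m - 1, by omega⟩
  have hZm : ∀ i, 1 ≤ i → i ≤ m → Z.coeff i ∈ g i := fun i h1 h2 => ih i (by omega) h1
  have hrad : ∀ k, ∀ i ≤ m, ((rad Z ^ (k + 1)) (realDerivative Z)).coeff i ∈ g (i + 1) := by
    intro k
    induction k with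
    | zero =>
      rw [zero_add, pow_one]
      refine coeff_rad_mem hg hZ0 hZm fun i hi => ?_
      rw [hd, coeff_derivative]
      have := (g (i + 1)).smul_mem ((i : ℝ) + 1) (hZm (i + 1) (by omega) (by omega))
      rwa [Algebra.smul_def, Algebra.commutes, map_add, map_natCast, map_one] at this
    | succ k ihk =>
      rw [pow_succ', Module.End.mul_apply]
      exact coeff_rad_mem hg hZ0 hZm fun i hi => ihk i hi.le
  have h1 : (realDerivative Z).coeff m ∈ g (m + 1) := by
    rw [← eq_sub_iff_add_eq'] at hZd
    rw [hZd, coeff_sub, finsetSum_coeff]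
    refine (g _).sub_mem (hcg m) ((g _).sum_mem fun k _ => ?_)
    rw [coeff_smul]
    exact (g _).smul_mem _ (hrad k m le_rfl)
  rw [hd, coeff_derivative] at h1
  have h2 := (g (m + 1)).smul_mem ((m : ℝ) + 1)⁻¹ h1
  have h3 : Z.coeff (m + 1) * ((m : A) + 1) = ((m : ℝ) + 1) • Z.coeff (m + 1) := by
    rw [Algebra.smul_def, Algebra.commutes, map_add, map_natCast, map_one]
  rwa [h3, smul_smul, inv_mul_cancel₀ (by positivity), one_smul] at h2

end GradedLog

/-! ### Layers, projections and the associated filtration -/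

namespace BanachHomogeneousGroup

section Layers

variable {M : Type*} [NormedAddCommGroup M] [NormedSpace ℝ M] (H : BanachHomogeneousGroup M)

/-- The projection `π_i` as a linear map. -/
noncomputable def projL (i : ℕ) : M →ₗ[ℝ] M :=
  (H.layer i).subtype ∘ₗ DirectSum.component ℝ ℕ (fun i => H.layer i) i ∘ₗ
    (LinearEquiv.ofBijective (DirectSum.coeLinearMap H.layer) H.bijective_sum).symm.toLinearMap

theorem projL_apply (i : ℕ) (x : M) : H.projL i x = H.proj i x := rfl

theorem proj_mem (i : ℕ) (x : M) : H.proj i x ∈ H.layer i := SetLike.coe_mem _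

theorem proj_of_mem {i : ℕ} {x : M} (hx : x ∈ H.layer i) (j : ℕ) :
    H.proj j x = if j = i then x else 0 := by
  have h : (LinearEquiv.ofBijective (DirectSum.coeLinearMap H.layer) H.bijective_sum).symm x =
      DirectSum.lof ℝ ℕ (fun i => H.layer i) i ⟨x, hx⟩ := by
    rw [LinearEquiv.symm_apply_eq]
    simp
  rw [proj, h, DirectSum.lof_eq_of]
  split_ifs with hij
  · subst hij
    rw [DirectSum.of_eq_same]
  · rw [DirectSum.of_eq_of_ne _ _ _ hij]
    rfl

theorem proj_self {i : ℕ} {x : M} (hx : x ∈ H.layer i) : H.proj i x = x := by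
  rw [H.proj_of_mem hx, if_pos rfl]

theorem proj_eq_zero {i : ℕ} (hi : i = 0 ∨ H.step < i) (x : M) : H.proj i x = 0 := by
  have := H.proj_mem i x
  rwa [H.layer_eq_bot i hi, Submodule.mem_bot] at this

theorem sum_proj (x : M) : ∑ i ∈ Finset.Icc 1 H.step, H.proj i x = x := by
  classical
  set e := LinearEquiv.ofBijective (DirectSum.coeLinearMap H.layer) H.bijective_sum with he
  have h : x = DirectSum.coeLinearMap H.layer (e.symm x) := by
    have := e.apply_symm_apply x
    exact this.symm
  conv_rhs => rw [h]
  rw [DirectSum.coeLinearMap_eq_dfinsuppSum, DFinsupp.sum]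
  symm
  refine Finset.sum_subset (fun i hi => ?_) fun i _ hi => ?_
  · rw [Finset.mem_Icc]
    by_contra hcon
    have hne := DFinsupp.mem_support_iff.mp hi
    apply hne
    have := H.proj_eq_zero (i := i) (by omega) x
    exact Subtype.ext this
  · rw [DFinsupp.notMem_support_iff] at hi
    exact congrArg Subtype.val hi

theorem ext_proj {x y : M} (h : ∀ i, 1 ≤ i → i ≤ H.step → H.proj i x = H.proj i y) : x = y := by
  rw [← H.sum_proj x, ← H.sum_proj y]
  exact Finset.sum_congr rfl fun i hi => h i (Finset.mem_Icc.mp hi).1 (Finset.mem_Icc.mp hi).2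

@[simp] theorem proj_add (i : ℕ) (x y : M) : H.proj i (x + y) = H.proj i x + H.proj i y :=
  (H.projL i).map_add x y

@[simp] theorem proj_sub (i : ℕ) (x y : M) : H.proj i (x - y) = H.proj i x - H.proj i y :=
  (H.projL i).map_sub x y

@[simp] theorem proj_neg (i : ℕ) (x : M) : H.proj i (-x) = -H.proj i x :=
  (H.projL i).map_neg x

@[simp] theorem proj_smul (i : ℕ) (r : ℝ) (x : M) : H.proj i (r • x) = r • H.proj i x :=
  (H.projL i).map_smul r x

@[simp] theorem proj_zero (i : ℕ) : H.proj i (0 : M) = 0 := (H.projL i).map_zero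

/-- Additive properties may be checked on homogeneous vectors. -/
theorem layer_induction {p : M → Prop} (h0 : p 0) (hadd : ∀ x y, p x → p y → p (x + y))
    (hl : ∀ i x, 1 ≤ i → i ≤ H.step → x ∈ H.layer i → p x) (x : M) : p x := by
  rw [← H.sum_proj x]
  exact Finset.sum_induction _ p hadd h0 fun i hi =>
    hl i _ (Finset.mem_Icc.mp hi).1 (Finset.mem_Icc.mp hi).2 (H.proj_mem i x)

/-- The linear map acting on the layer `H_i` as multiplication by `c i`. -/
noncomputable def scale (c : ℕ → ℝ) : M →ₗ[ℝ] M :=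
  ∑ i ∈ Finset.Icc 1 H.step, c i • H.projL i

theorem scale_apply (c : ℕ → ℝ) (x : M) :
    H.scale c x = ∑ i ∈ Finset.Icc 1 H.step, c i • H.proj i x := by
  simp [scale, LinearMap.sum_apply, projL_apply]

theorem dil_eq_scale (r : ℝ) (x : M) : H.dil r x = H.scale (fun i => r ^ i) x := by
  rw [scale_apply, dil]

theorem scale_of_mem (c : ℕ → ℝ) {i : ℕ} {x : M} (hx : x ∈ H.layer i) :
    H.scale c x = c i • x := by
  rw [scale_apply]
  by_cases hi : i = 0 ∨ H.step < i
  · have : x = 0 := by rwa [H.layer_eq_bot i hi, Submodule.mem_bot] at hx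
    simp [this]
  · rw [Finset.sum_eq_single i]
    · rw [H.proj_self hx]
    · intro j _ hj
      rw [H.proj_of_mem hx, if_neg hj, smul_zero]
    · intro h
      exact absurd (Finset.mem_Icc.mpr (by omega)) h

theorem proj_scale (c : ℕ → ℝ) (i : ℕ) (x : M) : H.proj i (H.scale c x) = c i • H.proj i x := by
  induction x using H.layer_induction with
  | h0 => simp
  | hadd x y hx hy => simp [hx, hy]
  | hl j x _ _ hx =>
    rw [H.scale_of_mem c hx, proj_smul, H.proj_of_mem hx]
    split_ifs with h
    · rw [h]
    · simp

/-- The vectors whose components in the layers `H_i`, `i < k`, vanish. -/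
def filt (k : ℕ) : Submodule ℝ M where
  carrier := {x | ∀ i < k, H.proj i x = 0}
  add_mem' := fun hx hy i hi => by rw [proj_add, hx i hi, hy i hi, add_zero]
  zero_mem' := fun i _ => H.proj_zero i
  smul_mem' := fun r x hx i hi => by rw [proj_smul, hx i hi, smul_zero]

theorem mem_filt {k : ℕ} {x : M} : x ∈ H.filt k ↔ ∀ i < k, H.proj i x = 0 := Iff.rfl

theorem mem_filt_one (x : M) : x ∈ H.filt 1 :=
  fun _ hi => H.proj_eq_zero (Or.inl (by omega)) x

theorem filt_anti {j k : ℕ} (h : j ≤ k) : H.filt k ≤ H.filt j :=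
  fun _ hx i hi => hx i (hi.trans_le h)

theorem eq_zero_of_mem_filt {k : ℕ} (hk : H.step < k) {x : M} (hx : x ∈ H.filt k) : x = 0 :=
  H.ext_proj fun i _ h2 => by rw [hx i (h2.trans_lt hk), proj_zero]

theorem layer_le_filt {i k : ℕ} (h : k ≤ i) : H.layer i ≤ H.filt k := by
  intro x hx j hj
  rw [H.proj_of_mem hx, if_neg (by omega)]

theorem mem_filt_succ_iff {k : ℕ} {x : M} :
    x ∈ H.filt (k + 1) ↔ x ∈ H.filt k ∧ H.proj k x = 0 := by
  simp only [mem_filt, Nat.lt_succ_iff_lt_or_eq]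
  grind

theorem bracket_mem_filt {j k : ℕ} {x y : M} (hx : x ∈ H.filt j) (hy : y ∈ H.filt k) :
    H.bracket x y ∈ H.filt (j + k) := by
  rw [← H.sum_proj x, ← H.sum_proj y]
  simp only [map_sum, sum_apply]
  refine Submodule.sum_mem _ fun l _ => Submodule.sum_mem _ fun i _ => ?_
  rcases lt_or_ge i j with h | h
  · simp [hx i h]
  rcases lt_or_ge l k with h' | h'
  · simp [hy l h']
  exact H.layer_le_filt (add_le_add h h')
    (H.bracket_mem i l _ _ (H.proj_mem i x) (H.proj_mem l y))

/-- The linear map acting on the layer `H_i` as multiplication by `i`: the derivation which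
generates the dilations. -/
noncomputable def degree : M →ₗ[ℝ] M := H.scale fun i => (i : ℝ)

theorem degree_bracket (x y : M) :
    H.degree (H.bracket x y) = H.bracket (H.degree x) y + H.bracket x (H.degree y) := by
  induction x using H.layer_induction with
  | h0 => simp
  | hadd x x' hx hx' => simp only [map_add, add_apply, hx, hx']; abel
  | hl i x _ _ hx =>
    induction y using H.layer_induction with
    | h0 => simp
    | hadd y y' hy hy' => simp only [map_add, hy, hy']; abel
    | hl j y _ _ hy =>
      rw [degree, H.scale_of_mem _ (H.bracket_mem i j x y hx hy), H.scale_of_mem _ hx,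
        H.scale_of_mem _ hy]
      simp [add_smul]

theorem degree_injective : Function.Injective H.degree := by
  intro x y h
  refine H.ext_proj fun i hi _ => ?_
  have := congrArg (H.proj i) h
  rw [degree, proj_scale, proj_scale] at this
  exact smul_right_injective M (by positivity : (i : ℝ) ≠ 0) this

theorem dil_bracket (r : ℝ) (x y : M) :
    H.dil r (H.bracket x y) = H.bracket (H.dil r x) (H.dil r y) := by
  simp only [dil_eq_scale]
  induction x using H.layer_induction with
  | h0 => simp
  | hadd x x' hx hx' => simp only [map_add, add_apply, hx, hx']
  | hl i x _ _ hx =>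
    induction y using H.layer_induction with
    | h0 => simp
    | hadd y y' hy hy' => simp only [map_add, hy, hy']
    | hl j y _ _ hy =>
      rw [H.scale_of_mem _ (H.bracket_mem i j x y hx hy), H.scale_of_mem _ hx,
        H.scale_of_mem _ hy]
      simp [pow_add, smul_smul, mul_comm]

theorem dil_iterBracket (r : ℝ) (l : List M) :
    H.dil r (H.iterBracket l) = H.iterBracket (l.map (H.dil r)) := by
  cases l with
  | nil => simp [iterBracket, dil_eq_scale]
  | cons a l =>
    simp only [iterBracket, List.map_cons]
    induction l generalizing a with
    | nil => rfl
    | cons b l ih => rw [List.foldl_cons, ih, List.map_cons, List.foldl_cons, dil_bracket]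

theorem dil_add (r : ℝ) (x y : M) : H.dil r (x + y) = H.dil r x + H.dil r y := by
  simp [dil_eq_scale]

theorem dil_neg (r : ℝ) (x : M) : H.dil r (-x) = -H.dil r x := by
  simp [dil_eq_scale]

theorem dil_zero (r : ℝ) : H.dil r (0 : M) = 0 := by
  simp [dil_eq_scale]

theorem dil_dil (r s : ℝ) (x : M) : H.dil r (H.dil s x) = H.dil (r * s) x := by
  refine H.ext_proj fun i _ _ => ?_
  simp only [dil_eq_scale, proj_scale, smul_smul, mul_pow]

theorem dil_one (x : M) : H.dil 1 x = x := by
  refine H.ext_proj fun i _ _ => ?_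
  simp [dil_eq_scale, proj_scale]

/-- The dilations are automorphisms of the group. -/
theorem dil_mul (r : ℝ) (x y : M) : H.dil r (H.mul x y) = H.mul (H.dil r x) (H.dil r y) := by
  have h : ∀ m, H.dil r (H.dynkinPoly m x y) = H.dynkinPoly m (H.dil r x) (H.dil r y) := by
    intro m
    simp only [dynkinPoly]
    rw [dil_eq_scale]
    simp only [map_sum, map_smul]
    simp only [← dil_eq_scale, dil_iterBracket, List.map_flatten, List.map_ofFn]
    simp [Function.comp_def]
  rw [mul, mul, dil_add, dil_add]
  congr 1
  rw [dil_eq_scale, map_sum]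
  simp only [← dil_eq_scale, h]

end Layers

end BanachHomogeneousGroup

/-! ### Associativity of the group operation -/

section WordExpansion

open Polynomial

variable {A : Type*} [Ring A]

theorem sum_pow_eq_sum_piFinset {ι : Type*} (S : Finset ι) (F : ι → A) (k : ℕ) :
    (∑ b ∈ S, F b) ^ k = ∑ c ∈ Fintype.piFinset fun _ : Fin k => S,
      (List.ofFn fun i => F (c i)).reverse.prod := by
  classical
  induction k with
  | zero => simp
  | succ k ih =>
    rw [pow_succ, ih, Finset.sum_mul_sum, ← Finset.sum_product']
    refine Finset.sum_nbij' (fun p => Fin.cons p.2 p.1) (fun c => (Fin.tail c, c 0)) ?_ ?_ ?_ ?_ ?_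
    · intro p hp
      rw [Finset.mem_product, Fintype.mem_piFinset] at hp
      rw [Fintype.mem_piFinset]
      intro i
      cases i using Fin.cases with
      | zero => exact hp.2
      | succ i => exact hp.1 i
    · intro c hc
      rw [Fintype.mem_piFinset] at hc
      rw [Finset.mem_product, Fintype.mem_piFinset]
      exact ⟨fun i => hc i.succ, hc 0⟩
    · intro p _
      simp
    · intro c _
      simp
    · intro p _
      simp [List.ofFn_succ]

theorem list_prod_monomial (l : List (ℕ × A)) :
    (l.map fun p => (monomial p.1 p.2 : A[X])).prod =
      monomial (l.map Prod.fst).sum (l.map Prod.snd).prod := by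
  induction l with
  | nil => simp
  | cons a l ih => simp [ih, monomial_mul_monomial]

variable [Algebra ℝ A]

theorem list_prod_smul (l : List (ℝ × A)) :
    (l.map fun p => p.1 • p.2).prod = (l.map Prod.fst).prod • (l.map Prod.snd).prod := by
  induction l with
  | nil => simp
  | cons a l ih => simp [ih, smul_smul, mul_comm]

/-- Evaluation of polynomials over a noncommutative algebra at the central element `1`. -/
noncomputable def evalOne : A[X] →ₐ[ℝ] A :=
  { eval₂RingHom' (RingHom.id A) 1 (fun a => Commute.one_right a) with
    commutes' := fun r => by simp [eval₂RingHom', Polynomial.algebraMap_apply] }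

theorem evalOne_monomial (m : ℕ) (a : A) : evalOne (monomial m a) = a := by
  simp [evalOne, eval₂RingHom']

/-- The words occurring in degree `m` of `(e ^ (t y) e ^ (t x) - 1) ^ k` are those of Dynkin's
formula, read from right to left. -/
theorem coeff_exp_mul_exp_sub_one_pow (x y : A) (N k m : ℕ) (hm : m ≤ N) :
    ((truncExp N (monomial 1 y : A[X]) * truncExp N (monomial 1 x) - 1) ^ k).coeff m =
      ∑ c ∈ BanachHomogeneousGroup.dynkinIndex m k,
        (∏ i, (((c i).1.factorial : ℝ) * ((c i).2.factorial : ℝ)))⁻¹ •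
          (List.ofFn fun i => y ^ (c i).2 * x ^ (c i).1).reverse.prod := by
  set S : Finset (ℕ × ℕ) := (Finset.range (N + 1) ×ˢ Finset.range (N + 1)).erase (0, 0) with hS
  set r : ℕ × ℕ → ℝ := fun b => ((b.1.factorial : ℝ) * (b.2.factorial : ℝ))⁻¹ with hr
  have h1 : truncExp N (monomial 1 y : A[X]) * truncExp N (monomial 1 x) - 1 =
      ∑ b ∈ S, monomial (b.1 + b.2) (r b • (y ^ b.2 * x ^ b.1)) := by
    rw [sub_eq_iff_eq_add]
    have h0 := Finset.sum_erase_add (Finset.range (N + 1) ×ˢ Finset.range (N + 1))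
      (fun b : ℕ × ℕ => (monomial (b.1 + b.2) (r b • (y ^ b.2 * x ^ b.1)) : A[X]))
      (a := (0, 0)) (by simp)
    have h00 : (monomial (0 + 0) (r (0, 0) • (y ^ 0 * x ^ 0)) : A[X]) = 1 := by simp [hr]
    rw [h00] at h0
    rw [h0, truncExp, truncExp, Finset.sum_mul_sum, Finset.sum_comm, Finset.sum_product]
    refine Finset.sum_congr rfl fun p _ => Finset.sum_congr rfl fun q _ => ?_
    rw [monomial_pow, monomial_pow, smul_monomial, smul_monomial, monomial_mul_monomial,
      smul_mul_smul_comm]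
    simp [hr, add_comm]
  rw [h1, sum_pow_eq_sum_piFinset, finsetSum_coeff]
  have h2 : ∀ c : Fin k → ℕ × ℕ, (List.ofFn fun i =>
      (monomial ((c i).1 + (c i).2) (r (c i) • (y ^ (c i).2 * x ^ (c i).1)) : A[X])).reverse.prod =
      monomial (∑ i, ((c i).1 + (c i).2))
        ((∏ i, (((c i).1.factorial : ℝ) * ((c i).2.factorial : ℝ)))⁻¹ •
          (List.ofFn fun i => y ^ (c i).2 * x ^ (c i).1).reverse.prod) := by
    intro c
    have e1 := list_prod_monomial ((List.ofFn fun i =>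
      ((c i).1 + (c i).2, r (c i) • (y ^ (c i).2 * x ^ (c i).1))).reverse)
    have e2 := list_prod_smul ((List.ofFn fun i =>
      (r (c i), (y ^ (c i).2 * x ^ (c i).1))).reverse)
    simp only [List.map_reverse, List.map_ofFn, Function.comp_def, List.sum_reverse,
      List.sum_ofFn] at e1 e2
    rw [e1, e2, List.prod_reverse, List.prod_ofFn]
    simp only [hr, Finset.prod_inv_distrib]
  simp only [h2, coeff_monomial]
  rw [← Finset.sum_filter]
  refine Finset.sum_congr ?_ fun _ _ => rfl
  ext c
  simp only [Finset.mem_filter, Fintype.mem_piFinset, BanachHomogeneousGroup.dynkinIndex, hS,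
    Finset.mem_erase, Finset.mem_product, Finset.mem_range, ne_eq, Prod.ext_iff]
  constructor
  · rintro ⟨h, hs⟩
    refine ⟨fun i => ?_, fun i => ?_, hs⟩
    · have := Finset.single_le_sum (f := fun i => (c i).1 + (c i).2) (fun _ _ => Nat.zero_le _)
        (Finset.mem_univ i)
      omega
    · have := (h i).1
      omega
  · rintro ⟨h, h', hs⟩
    refine ⟨fun i => ?_, hs⟩
    have := h i
    have := h' i
    omega

end WordExpansion

namespace BanachHomogeneousGroup

variable {M : Type*} [NormedAddCommGroup M] [NormedSpace ℝ M] (H : BanachHomogeneousGroup M)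

section Representation

/-- For a linear map `T` of `M`, the operator of `M × ℝ` sending `(v, s)` to `([v, w] + s T w, 0)`:
bracketing with `w` on the right in the extension of `M` by an element acting as `T`. -/
noncomputable def rep (T : M →ₗ[ℝ] M) : M →ₗ[ℝ] Module.End ℝ (M × ℝ) where
  toFun w :=
    { toFun := fun p => (H.bracket p.1 w + p.2 • T w, 0)
      map_add' := fun p q => by
        ext <;> simp [add_smul]; abel
      map_smul' := fun r p => by
        ext <;> simp [smul_smul] }
  map_add' w w' := by
    refine LinearMap.ext fun p => ?_
    simp only [LinearMap.coe_mk, AddHom.coe_mk, LinearMap.add_apply, map_add, smul_add,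
      Prod.mk_add_mk, add_zero]
    congr 1
    abel
  map_smul' r w := by
    refine LinearMap.ext fun p => ?_
    simp [smul_comm r]

theorem rep_apply (T : M →ₗ[ℝ] M) (w : M) (p : M × ℝ) :
    H.rep T w p = (H.bracket p.1 w + p.2 • T w, 0) := rfl

/-- A vector of degree `m`, acting on two copies of `M × ℝ`: the first representation, by the
grading derivation of `M`, is faithful and independent of `m`; the second records `m`. -/
noncomputable def repPair (m : ℕ) :
    M →ₗ[ℝ] Module.End ℝ (M × ℝ) × Module.End ℝ (M × ℝ) :=
  (H.rep H.degree).prod (H.rep ((m : ℝ) • LinearMap.id))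

theorem jacobi_right (v w w' : M) :
    H.bracket (H.bracket v w) w' - H.bracket (H.bracket v w') w =
      H.bracket v (H.bracket w w') := by
  have h := H.jacobi v w w'
  rw [H.skew (H.bracket v w) w', H.skew (H.bracket v w') w, H.skew v w', map_neg]
  rw [eq_comm, ← sub_eq_zero, ← h]
  abel

theorem rep_commutator (T T' S : M →ₗ[ℝ] M) (w w' : M)
    (hS : S (H.bracket w w') = H.bracket (T w) w' - H.bracket (T' w') w) :
    H.rep T w * H.rep T' w' - H.rep T' w' * H.rep T w = H.rep S (-H.bracket w w') := by
  refine LinearMap.ext fun p => Prod.ext ?_ (sub_zero 0)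
  have := H.jacobi_right p.1 w w'
  simp only [LinearMap.sub_apply, LinearMap.neg_apply, Module.End.mul_apply, rep_apply, map_add,
    map_smul, map_neg, add_apply, smul_apply, zero_smul, add_zero, Prod.mk_sub_mk,
    Prod.fst_neg, hS, ← this]
  module

theorem repPair_commutator (m n : ℕ) (w w' : M) :
    H.repPair m w * H.repPair n w' - H.repPair n w' * H.repPair m w =
      H.repPair (m + n) (-H.bracket w w') := by
  have h1 := H.rep_commutator H.degree H.degree H.degree w w' (by
    rw [degree_bracket, H.skew w (H.degree w'), sub_eq_add_neg])
  have h2 := H.rep_commutator ((m : ℝ) • LinearMap.id) ((n : ℝ) • LinearMap.id)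
    (((m + n : ℕ) : ℝ) • LinearMap.id) w w' (by
      simp only [LinearMap.smul_apply, LinearMap.id_apply, map_smul,
        smul_apply, H.skew w' w, Nat.cast_add]
      module)
  exact Prod.ext h1 h2

/-- The filtration of `M × ℝ` which the operators `rep T w` raise by one. -/
def repFilt (k : ℕ) : Submodule ℝ (M × ℝ) where
  carrier := {p | p.1 ∈ H.filt k ∧ (1 ≤ k → p.2 = 0)}
  add_mem' := fun hp hq =>
    ⟨Submodule.add_mem _ hp.1 hq.1, fun h => by simp [hp.2 h, hq.2 h]⟩
  zero_mem' := ⟨Submodule.zero_mem _, fun _ => rfl⟩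
  smul_mem' := fun r p hp =>
    ⟨Submodule.smul_mem _ r hp.1, fun h => by simp [hp.2 h]⟩

theorem rep_mem_repFilt (T : M →ₗ[ℝ] M) (w : M) {k : ℕ} {p : M × ℝ} (hp : p ∈ H.repFilt k) :
    H.rep T w p ∈ H.repFilt (k + 1) := by
  refine ⟨?_, fun _ => rfl⟩
  rw [rep_apply]
  rcases Nat.eq_zero_or_pos k with h | h
  · rw [h]; exact H.mem_filt_one _
  · rw [hp.2 h, zero_smul, add_zero]
    exact H.bracket_mem_filt hp.1 (H.mem_filt_one w)

/-- The pairs of operators which raise the filtration `repFilt` by `n`. -/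
def repGrade (n : ℕ) : Submodule ℝ (Module.End ℝ (M × ℝ) × Module.End ℝ (M × ℝ)) where
  carrier := {a | ∀ k, ∀ p ∈ H.repFilt k, a.1 p ∈ H.repFilt (k + n) ∧ a.2 p ∈ H.repFilt (k + n)}
  add_mem' := fun ha hb k p hp =>
    ⟨Submodule.add_mem _ (ha k p hp).1 (hb k p hp).1,
      Submodule.add_mem _ (ha k p hp).2 (hb k p hp).2⟩
  zero_mem' := fun _ _ _ => ⟨Submodule.zero_mem _, Submodule.zero_mem _⟩
  smul_mem' := fun r _ ha k p hp =>
    ⟨Submodule.smul_mem _ r (ha k p hp).1, Submodule.smul_mem _ r (ha k p hp).2⟩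

theorem isNilGrading_repGrade : IsNilGrading H.repGrade H.step where
  one_mem := fun _ _ hp => ⟨hp, hp⟩
  mul_mem := by
    intro m n a b ha hb k p hp
    have h1 := ha _ _ (hb k p hp).1
    have h2 := ha _ _ (hb k p hp).2
    rw [show k + n + m = k + (m + n) by ring] at h1 h2
    exact ⟨h1.1, h2.2⟩
  eq_zero := by
    intro m hm a ha
    have h0 : ∀ p ∈ H.repFilt (0 + m), p = 0 := fun p hp =>
      Prod.ext (H.eq_zero_of_mem_filt (by omega) hp.1) (hp.2 (by omega))
    have ht : ∀ p, p ∈ H.repFilt 0 := fun p =>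
      ⟨fun i hi => absurd hi (by omega), fun h => absurd h (by omega)⟩
    exact Prod.ext (LinearMap.ext fun p => h0 _ (ha 0 p (ht p)).1)
      (LinearMap.ext fun p => h0 _ (ha 0 p (ht p)).2)

theorem repPair_mem (m : ℕ) (w : M) : H.repPair m w ∈ H.repGrade 1 :=
  fun _ _ hp => ⟨H.rep_mem_repFilt _ w hp, H.rep_mem_repFilt _ w hp⟩

theorem rep_degree_pow (w : M) : H.rep H.degree w ^ (H.step + 1) = 0 := by
  have h : ∀ n, H.repPair 1 w ^ n ∈ H.repGrade n := by
    intro n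
    induction n with
    | zero => rw [pow_zero]; exact H.isNilGrading_repGrade.one_mem
    | succ n ih =>
      rw [pow_succ]
      exact H.isNilGrading_repGrade.mul_mem _ _ _ _ ih (H.repPair_mem 1 w)
  exact congrArg Prod.fst (H.isNilGrading_repGrade.eq_zero _ (Nat.lt_succ_self _) _ (h _))

theorem rep_degree_injective : Function.Injective (H.rep H.degree) := by
  intro w w' h
  have h1 := congrArg (fun φ : Module.End ℝ (M × ℝ) => (φ (0, 1)).1) h
  simp only [rep_apply, map_zero, zero_apply, one_smul, zero_add] at h1
  exact H.degree_injective h1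

theorem foldl_rep_eq (v : M) (l : List M) :
    l.foldl (fun p a => H.rep LinearMap.id a p) (v, 0) =
      (l.foldl (fun u a => H.bracket u a) v, 0) := by
  induction l generalizing v with
  | nil => rfl
  | cons a l ih => rw [List.foldl_cons, rep_apply, zero_smul, add_zero, ih]; rfl

/-- In the representation recording degrees, words applied to `(0, 1)` are iterated brackets. -/
theorem foldl_rep_eq_iterBracket {l : List M} (hl : l ≠ []) :
    l.foldl (fun p a => H.rep LinearMap.id a p) (0, 1) = (H.iterBracket l, 0) := by
  cases l with
  | nil => exact absurd rfl hl
  | cons a l =>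
    rw [List.foldl_cons, rep_apply, map_zero, zero_apply, one_smul, zero_add, foldl_rep_eq]
    rfl

theorem foldl_replicate_rep (x : M) (n : ℕ) (p : M × ℝ) :
    (List.replicate n x).foldl (fun p a => H.rep LinearMap.id a p) p =
      (H.rep LinearMap.id x ^ n) p := by
  induction n generalizing p with
  | zero => rfl
  | succ n ih => rw [List.replicate_succ, List.foldl_cons, ih, pow_succ]; rfl

theorem prod_reverse_rep_apply (x y : M) (l : List (ℕ × ℕ)) (p : M × ℝ) :
    (l.map fun b => H.rep LinearMap.id y ^ b.2 * H.rep LinearMap.id x ^ b.1).reverse.prod p =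
      (l.map fun b => List.replicate b.1 x ++ List.replicate b.2 y).flatten.foldl
        (fun p a => H.rep LinearMap.id a p) p := by
  induction l generalizing p with
  | nil => rfl
  | cons b l ih =>
    rw [List.map_cons, List.reverse_cons, List.prod_append, List.prod_singleton,
      Module.End.mul_apply, ih, List.map_cons, List.flatten_cons, List.foldl_append,
      List.foldl_append, foldl_replicate_rep, foldl_replicate_rep]
    rfl

theorem dynkinIndex_eq_empty {m k : ℕ} (h : m < k) : dynkinIndex m k = ∅ := by
  rw [Finset.eq_empty_iff_forall_notMem]
  intro c hc
  obtain ⟨-, h1, h2⟩ := Finset.mem_filter.mp hc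
  have : ∑ i : Fin k, 1 ≤ ∑ i, ((c i).1 + (c i).2) := Finset.sum_le_sum fun i _ => h1 i
  simp only [Finset.sum_const, Finset.card_univ, Fintype.card_fin, smul_eq_mul, mul_one] at this
  omega

theorem dynkinPoly_one (x y : M) : H.dynkinPoly 1 x y = x + y := by
  have h : dynkinIndex 1 1 = {fun _ => (1, 0), fun _ => (0, 1)} := by decide
  rw [dynkinPoly, Finset.Icc_self, Finset.sum_singleton, h, Finset.sum_pair (by decide)]
  simp [iterBracket]

open Polynomial in
/-- The Baker-Campbell-Hausdorff formula: in the faithful representation of `M`, the group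
operation corresponds to the product of exponentials (in the opposite order, as the
representation is by right brackets). -/
theorem truncExp_rep_mul (x y : M) :
    truncExp H.step (H.rep H.degree (H.mul x y)) =
      truncExp H.step (H.rep H.degree y) * truncExp H.step (H.rep H.degree x) := by
  obtain h0 | hN := Nat.eq_zero_or_pos H.step
  · simp [h0, truncExp]
  set N := H.step with hNdef
  set W := truncExp N (monomial 1 (H.repPair 1 y)) * truncExp N (monomial 1 (H.repPair 1 x))
    with hW
  set Z := truncLog N W with hZ
  have hJ := H.isNilGrading_repGrade
  have hbch := coeff_truncLog_mem (g := fun m => LinearMap.range (H.repPair m)) hJ (by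
    rintro m n _ _ ⟨w, rfl⟩ ⟨w', rfl⟩
    exact ⟨_, (H.repPair_commutator m n w w').symm⟩)
    (H.repPair_mem 1 x) (H.repPair_mem 1 y) ⟨x, rfl⟩ ⟨y, rfl⟩
  have hexp : truncExp N Z = W := (hbch 1 le_rfl).2
  have hX0 : ∀ u, (monomial 1 (H.repPair 1 u)).coeff 0 = 0 := fun u => by simp [coeff_monomial]
  have hZ0 : Z.coeff 0 = 0 := by
    refine coeff_zero_truncLog ?_ N
    rw [hW, mul_coeff_zero, coeff_zero_truncExp (hX0 x), coeff_zero_truncExp (hX0 y), mul_one]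
  have hZJ : Z ∈ gradedPoly H.repGrade :=
    hJ.poly_truncLog_mem (hJ.poly_mul_mem
      (hJ.poly_truncExp_mem (monomial_one_mem_gradedPoly (H.repPair_mem 1 y)))
      (hJ.poly_truncExp_mem (monomial_one_mem_gradedPoly (H.repPair_mem 1 x))))
  -- evaluating the degree `m` part at `(0, 1)` identifies it with Dynkin's polynomial
  have hcoeff : ∀ m ∈ Finset.Icc 1 N, Z.coeff m = H.repPair m (H.dynkinPoly m x y) := by
    intro m hm
    obtain ⟨hm1, hmN⟩ := Finset.mem_Icc.mp hm
    obtain ⟨z, hz⟩ := (hbch m hm1).1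
    rw [← hW, ← hZ] at hz
    rw [← hz]
    congr 1
    have hm0 : (m : ℝ) ≠ 0 := by positivity
    have h1 : ((Z.coeff m).2 (0, 1)).1 = (m : ℝ) • z := by
      rw [← hz]
      simp [repPair, rep_apply]
    have h2 : ∀ k ∈ Finset.Icc 1 N, (((W - 1) ^ k).coeff m).2 (0, 1) =
        ∑ c ∈ dynkinIndex m k,
          (∏ i, (((c i).1.factorial : ℝ) * ((c i).2.factorial : ℝ)))⁻¹ •
            (H.iterBracket (List.ofFn fun i =>
              List.replicate (c i).1 x ++ List.replicate (c i).2 y).flatten, (0 : ℝ)) := by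
      intro k hk
      rw [hW, coeff_exp_mul_exp_sub_one_pow _ _ N k m hmN, Prod.snd_sum, LinearMap.sum_apply]
      refine Finset.sum_congr rfl fun c hc => ?_
      rw [Prod.smul_snd, LinearMap.smul_apply]
      congr 1
      have hsnd : ∀ u, (H.repPair 1 u).2 = H.rep LinearMap.id u := fun u => by simp [repPair]
      have hlist : ((List.ofFn fun i =>
          H.repPair 1 y ^ (c i).2 * H.repPair 1 x ^ (c i).1).reverse.prod).2 =
          ((List.ofFn c).map fun b =>
            H.rep LinearMap.id y ^ b.2 * H.rep LinearMap.id x ^ b.1).reverse.prod := by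
        have := map_list_prod (RingHom.snd (Module.End ℝ (M × ℝ)) (Module.End ℝ (M × ℝ)))
          (List.ofFn fun i => H.repPair 1 y ^ (c i).2 * H.repPair 1 x ^ (c i).1).reverse
        rw [RingHom.coe_snd] at this
        rw [this, List.map_reverse, List.map_ofFn, List.map_ofFn]
        simp [Function.comp_def, hsnd]
      rw [hlist, prod_reverse_rep_apply, List.map_ofFn, foldl_rep_eq_iterBracket]
      · rfl
      · obtain ⟨-, h1, h2⟩ := Finset.mem_filter.mp hc
        intro hnil
        have := congrArg List.length hnil
        simp only [List.length_flatten, List.map_ofFn, List.sum_ofFn, Function.comp_def,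
          List.length_append, List.length_replicate, List.length_nil] at this
        omega
    have h3 : (m : ℝ) • z = (m : ℝ) • H.dynkinPoly m x y := by
      rw [← h1, hZ, truncLog, finsetSum_coeff, Prod.snd_sum, LinearMap.sum_apply, Prod.fst_sum,
        dynkinPoly, Finset.smul_sum]
      symm
      refine Finset.sum_subset_zero_on_sdiff (Finset.Icc_subset_Icc_right hmN) ?_ ?_
      · intro k hk
        simp only [Finset.mem_sdiff, Finset.mem_Icc, not_and, not_le] at hk
        rw [coeff_smul, Prod.smul_snd, LinearMap.smul_apply, h2 k (Finset.mem_Icc.mpr hk.1),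
          dynkinIndex_eq_empty (hk.2 hk.1.1)]
        simp
      · intro k hk
        have hk' : k ∈ Finset.Icc 1 N := Finset.Icc_subset_Icc_right hmN hk
        rw [coeff_smul, Prod.smul_snd, LinearMap.smul_apply, h2 k hk', Prod.smul_fst,
          Prod.fst_sum, Finset.smul_sum, Finset.smul_sum]
        refine Finset.sum_congr rfl fun c _ => ?_
        rw [Prod.smul_fst, smul_smul, smul_smul]
        congr 1
        field_simp
    exact smul_right_injective M hm0 h3
  have hsum : Z = ∑ m ∈ Finset.Icc 1 N, monomial m (H.repPair m (H.dynkinPoly m x y)) := by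
    ext1 m
    rw [finsetSum_coeff]
    simp only [coeff_monomial, Finset.sum_ite_eq']
    split_ifs with hm
    · exact hcoeff m hm
    · rcases Nat.eq_zero_or_pos m with h | h
      · rw [h, hZ0]
      · exact hJ.eq_zero m (by simp at hm; omega) _ (hZJ m)
  -- evaluation at `t = 1`, followed by the projection to the faithful representation
  set φ := (AlgHom.fst ℝ (Module.End ℝ (M × ℝ)) (Module.End ℝ (M × ℝ))).comp
    (evalOne (A := Module.End ℝ (M × ℝ) × Module.End ℝ (M × ℝ))) with hφ
  have hφm : ∀ m a, φ (monomial m a) = a.1 := fun m a => by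
    rw [hφ, AlgHom.comp_apply, evalOne_monomial]; rfl
  have hφZ : φ Z = H.rep H.degree (H.mul x y) := by
    have hmul : H.mul x y = ∑ m ∈ Finset.Icc 1 N, H.dynkinPoly m x y := by
      rw [mul, ← H.dynkinPoly_one x y,
        show Finset.Icc 1 N = insert 1 (Finset.Icc 2 N) by ext; simp; omega,
        Finset.sum_insert (by simp)]
    rw [hsum, map_sum, hmul, map_sum]
    exact Finset.sum_congr rfl fun m _ => hφm m _
  have := congrArg φ hexp
  rw [map_truncExp, hφZ, hW, map_mul, map_truncExp, map_truncExp, hφm, hφm] at this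
  exact this

theorem mul_assoc' (x y z : M) : H.mul (H.mul x y) z = H.mul x (H.mul y z) := by
  apply H.rep_degree_injective
  rw [← truncLog_truncExp (H.rep_degree_pow (H.mul (H.mul x y) z)),
    ← truncLog_truncExp (H.rep_degree_pow (H.mul x (H.mul y z)))]
  simp only [truncExp_rep_mul, mul_assoc]

end Representation

end BanachHomogeneousGroup

/-! ### The group law: identities, leading terms, continuity -/

namespace BanachHomogeneousGroup

variable {M : Type*} [NormedAddCommGroup M] [NormedSpace ℝ M] (H : BanachHomogeneousGroup M)

section GroupLaw

theorem truncExp_rep_injective :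
    Function.Injective fun w => truncExp H.step (H.rep H.degree w) := by
  intro w w' h
  apply H.rep_degree_injective
  rw [← truncLog_truncExp (H.rep_degree_pow w), ← truncLog_truncExp (H.rep_degree_pow w')]
  exact congrArg _ h

theorem truncExp_zero {B : Type*} [Ring B] [Algebra ℝ B] (N : ℕ) : truncExp N (0 : B) = 1 := by
  rw [truncExp, Finset.sum_range_succ']
  simp

theorem mul_zero' (x : M) : H.mul x 0 = x := by
  apply H.truncExp_rep_injective
  simp [truncExp_rep_mul, truncExp_zero]

theorem zero_mul' (x : M) : H.mul 0 x = x := by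
  apply H.truncExp_rep_injective
  simp [truncExp_rep_mul, truncExp_zero]

theorem mul_neg_self (x : M) : H.mul x (-x) = 0 := H.mul_inv_self x

theorem neg_mul_self (x : M) : H.mul (-x) x = 0 := by
  simpa using H.mul_neg_self (-x)

theorem neg_mul_cancel_left (x y : M) : H.mul (-x) (H.mul x y) = y := by
  rw [← mul_assoc', neg_mul_self, zero_mul']

theorem mul_neg_cancel_left (x y : M) : H.mul x (H.mul (-x) y) = y := by
  rw [← mul_assoc', mul_neg_self, zero_mul']

theorem mul_left_injective' (x : M) : Function.Injective (H.mul x) := fun y z h => by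
  rw [← H.neg_mul_cancel_left x y, h, neg_mul_cancel_left]

theorem neg_mul' (x y : M) : -H.mul x y = H.mul (-y) (-x) := by
  apply H.mul_left_injective' (H.mul x y)
  rw [mul_neg_self, mul_assoc', mul_neg_cancel_left, mul_neg_self]

end GroupLaw

section LeadingTerms

/-- The word of a Dynkin index, with `true` for the first variable. -/
def dynkinWord {k : ℕ} (c : Fin k → ℕ × ℕ) : List Bool :=
  (List.ofFn fun i => List.replicate (c i).1 true ++ List.replicate (c i).2 false).flatten

theorem dynkinPoly_eq (m : ℕ) (x y : M) : H.dynkinPoly m x y =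
    ∑ k ∈ Finset.Icc 1 m, ∑ c ∈ dynkinIndex m k,
      ((-1 : ℝ) ^ (k - 1) / k *
          ((m : ℝ)⁻¹ / ∏ i, (((c i).1.factorial : ℝ) * ((c i).2.factorial : ℝ)))) •
        H.iterBracket ((dynkinWord c).map fun b => cond b x y) := by
  simp [dynkinPoly, dynkinWord, List.map_flatten, List.map_ofFn, Function.comp_def]

theorem length_dynkinWord {m k : ℕ} {c : Fin k → ℕ × ℕ} (hc : c ∈ dynkinIndex m k) :
    (dynkinWord c).length = m := by
  have hs := (Finset.mem_filter.mp hc).2.2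
  simp only [dynkinWord, List.length_flatten, List.map_ofFn, List.sum_ofFn, Function.comp_def,
    List.length_append, List.length_replicate]
  exact hs

theorem foldl_bracket_sub_mem {k n : ℕ} {f f' : Bool → M} (hf : ∀ b, f b - f' b ∈ H.filt k)
    (l : List Bool) {u u' : M} (hu : u - u' ∈ H.filt (k + n)) (hu' : u' ∈ H.filt (n + 1)) :
    (l.map f).foldl (fun v a => H.bracket v a) u - (l.map f').foldl (fun v a => H.bracket v a) u' ∈
      H.filt (k + n + l.length) := by
  induction l generalizing n u u' with
  | nil => exact hu
  | cons b l ih =>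
    have h1 : H.bracket u (f b) - H.bracket u' (f' b) =
        H.bracket (u - u') (f b) + H.bracket u' (f b - f' b) := by
      simp only [map_sub, sub_apply]
      abel
    have h := ih (n := n + 1) (u := H.bracket u (f b)) (u' := H.bracket u' (f' b)) (by
      rw [h1]
      refine Submodule.add_mem _ (H.bracket_mem_filt (j := k + n) hu (H.mem_filt_one _)) ?_
      have := H.bracket_mem_filt hu' (hf b)
      rwa [show n + 1 + k = k + (n + 1) by ring] at this)
      (H.bracket_mem_filt hu' (H.mem_filt_one _))
    simp only [List.map_cons, List.foldl_cons, List.length_cons]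
    rwa [show k + n + (l.length + 1) = k + (n + 1) + l.length by ring]

/-- Changing the entries of an iterated bracket of length `m` by elements of `filt k` changes it
by an element of `filt (k + m - 1)`. -/
theorem iterBracket_sub_mem {k : ℕ} {f f' : Bool → M} (hf : ∀ b, f b - f' b ∈ H.filt k)
    (l : List Bool) :
    H.iterBracket (l.map f) - H.iterBracket (l.map f') ∈ H.filt (k + l.length - 1) := by
  cases l with
  | nil => simp [iterBracket]
  | cons b l =>
    have := H.foldl_bracket_sub_mem (n := 0) hf l (hf b) (H.mem_filt_one _)
    simpa [iterBracket] using this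

theorem dynkinPoly_sub_mem {k : ℕ} {x y x' y' : M} (hx : x - x' ∈ H.filt k)
    (hy : y - y' ∈ H.filt k) (m : ℕ) :
    H.dynkinPoly m x y - H.dynkinPoly m x' y' ∈ H.filt (k + m - 1) := by
  rw [dynkinPoly_eq, dynkinPoly_eq]
  simp only [← Finset.sum_sub_distrib, ← smul_sub]
  refine Submodule.sum_mem _ fun j _ => Submodule.sum_mem _ fun c hc =>
    Submodule.smul_mem _ _ ?_
  rw [← length_dynkinWord hc]
  apply H.iterBracket_sub_mem
  rintro (_ | _)
  exacts [hy, hx]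

/-- Modulo `filt (k + 1)`, the nonlinear part of the product only depends on the factors
modulo `filt k`. -/
theorem mul_sub_add_sub_mem {k : ℕ} {x y x' y' : M} (hx : x - x' ∈ H.filt k)
    (hy : y - y' ∈ H.filt k) :
    (H.mul x y - (x + y)) - (H.mul x' y' - (x' + y')) ∈ H.filt (k + 1) := by
  rw [mul, mul, add_sub_cancel_left, add_sub_cancel_left, ← Finset.sum_sub_distrib]
  refine Submodule.sum_mem _ fun m hm => ?_
  have := (Finset.mem_Icc.mp hm).1
  exact H.filt_anti (by omega) (H.dynkinPoly_sub_mem hx hy m)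

theorem mul_sub_add_mem {k : ℕ} {x y : M} (hx : x ∈ H.filt k) (hy : y ∈ H.filt k) :
    H.mul x y - (x + y) ∈ H.filt (k + 1) := by
  have := H.mul_sub_add_sub_mem (x' := 0) (y' := 0) (by simpa using hx) (by simpa using hy)
  simpa [mul_zero'] using this

theorem mul_neg_sub_mem {k : ℕ} {x y : M} (h : x - y ∈ H.filt k) :
    H.mul x (-y) - (x - y) ∈ H.filt (k + 1) := by
  have := H.mul_sub_add_sub_mem (x := x) (y := -y) (x' := y) (y' := -y) h (by simp)
  simpa [mul_neg_self, sub_eq_add_neg] using this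

theorem mul_mem_filt {k : ℕ} {x y : M} (hx : x ∈ H.filt k) (hy : y ∈ H.filt k) :
    H.mul x y ∈ H.filt k := by
  have := H.filt_anti (Nat.le_succ k) (H.mul_sub_add_mem hx hy)
  simpa using Submodule.add_mem _ this (Submodule.add_mem _ hx hy)

theorem proj_mul_of_mem_filt {k : ℕ} {x y : M} (hx : x ∈ H.filt k) (hy : y ∈ H.filt k) :
    H.proj k (H.mul x y) = H.proj k x + H.proj k y := by
  have := H.mul_sub_add_mem hx hy k (Nat.lt_succ_self k)
  simpa [sub_eq_zero] using this

theorem dynkinPoly_two (x y : M) : H.dynkinPoly 2 x y = (1 / 2 : ℝ) • H.bracket x y := by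
  have h1 : dynkinIndex 2 1 = {fun _ => (2, 0), fun _ => (1, 1), fun _ => (0, 2)} := by decide
  have h2 : dynkinIndex 2 2 = {![(1, 0), (1, 0)], ![(1, 0), (0, 1)], ![(0, 1), (1, 0)],
      ![(0, 1), (0, 1)]} := by decide
  have h3 : Finset.Icc 1 2 = {1, 2} := by decide
  rw [dynkinPoly, h3, Finset.sum_pair (by decide), h1, h2]
  rw [Finset.sum_insert (by decide), Finset.sum_insert (by decide), Finset.sum_singleton,
    Finset.sum_insert (by decide), Finset.sum_insert (by decide), Finset.sum_insert (by decide),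
    Finset.sum_singleton]
  simp [iterBracket, bracket_self, H.skew y x]
  try norm_num

/-- Modulo `filt (k + 2)`, the products `x y` and `y x` with `y ∈ filt k` differ by `[x, y]`. -/
theorem mul_sub_mul_sub_bracket_mem {k : ℕ} {x y : M} (hy : y ∈ H.filt k) :
    H.mul x y - H.mul y x - H.bracket x y ∈ H.filt (k + 2) := by
  have hz : ∀ m, 2 ≤ m → ∀ u v : M, (u = 0 ∨ v = 0) → H.dynkinPoly m u v = 0 := by
    intro m hm u v huv
    rw [dynkinPoly_eq]
    refine Finset.sum_eq_zero fun j _ => Finset.sum_eq_zero fun c hc => ?_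
    have hlen := length_dynkinWord hc
    generalize dynkinWord c = l at hlen
    match l, hlen with
    | [], h => simp at h; omega
    | [_], h => simp at h; omega
    | a :: b :: l, _ =>
      have hab : H.bracket (cond a u v) (cond b u v) = 0 := by
        rcases huv with rfl | rfl <;> cases a <;> cases b <;> simp [bracket_self]
      have h0 : ∀ l : List M, l.foldl (fun u v => H.bracket u v) 0 = 0 := by
        intro l
        induction l with
        | nil => rfl
        | cons c l ih => simpa using ih
      simp [iterBracket, hab, h0]
  have hp : ∀ m, 3 ≤ m → H.dynkinPoly m x y - H.dynkinPoly m y x ∈ H.filt (k + 2) := by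
    intro m hm
    have h1 := H.dynkinPoly_sub_mem (x := x) (y := y) (x' := x) (y' := 0) (k := k) (by simp)
      (by simpa using hy) m
    have h2 := H.dynkinPoly_sub_mem (x := y) (y := x) (x' := 0) (y' := x) (k := k)
      (by simpa using hy) (by simp) m
    rw [hz m (by omega) _ _ (Or.inr rfl), sub_zero] at h1
    rw [hz m (by omega) _ _ (Or.inl rfl), sub_zero] at h2
    exact Submodule.sub_mem _ (H.filt_anti (by omega) h1) (H.filt_anti (by omega) h2)
  have h2 : H.dynkinPoly 2 x y - H.dynkinPoly 2 y x = H.bracket x y := by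
    rw [dynkinPoly_two, dynkinPoly_two, H.skew y x]
    module
  rcases lt_or_ge H.step 2 with hs | hs
  · have hb : H.bracket x y ∈ H.filt (k + 1) := by
      rw [add_comm]
      exact H.bracket_mem_filt (H.mem_filt_one x) hy
    have hb' : H.bracket x y = 0 :=
      H.eq_zero_of_mem_filt hs (H.bracket_mem_filt (H.mem_filt_one x) (H.mem_filt_one y))
    have : H.mul x y - H.mul y x - H.bracket x y = 0 := by
      rw [mul, mul, Finset.Icc_eq_empty (by omega), hb']
      simp [add_comm]
    rw [this]
    exact Submodule.zero_mem _
  · have : H.mul x y - H.mul y x - H.bracket x y =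
        ∑ m ∈ Finset.Icc 3 H.step, (H.dynkinPoly m x y - H.dynkinPoly m y x) := by
      rw [mul, mul, show Finset.Icc 2 H.step = insert 2 (Finset.Icc 3 H.step) by
        ext; simp; omega, Finset.sum_insert (by simp), Finset.sum_insert (by simp), ← h2,
        Finset.sum_sub_distrib]
      abel
    rw [this]
    exact Submodule.sum_mem _ fun m hm => hp m (Finset.mem_Icc.mp hm).1

/-- The group commutator of `x` and `y`. -/
noncomputable def comm (x y : M) : M := H.mul (H.mul x y) (-H.mul y x)

/-- The leading term of the group commutator is the bracket. -/
theorem comm_sub_bracket_mem {k : ℕ} {x y : M} (hy : y ∈ H.filt k) :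
    H.comm x y - H.bracket x y ∈ H.filt (k + 2) := by
  have h1 := H.mul_sub_mul_sub_bracket_mem (x := x) hy
  have hb : H.bracket x y ∈ H.filt (k + 1) := by
    rw [add_comm]
    exact H.bracket_mem_filt (H.mem_filt_one x) hy
  have h2 : H.mul x y - H.mul y x ∈ H.filt (k + 1) := by
    have := Submodule.add_mem _ (H.filt_anti (by omega) h1) hb
    simpa using this
  have h3 := Submodule.add_mem _ (H.mul_neg_sub_mem h2) h1
  rw [comm]
  convert h3 using 1
  abel

end LeadingTerms

section Continuity

theorem continuous_mul' : Continuous fun p : M × M => H.mul p.1 p.2 := by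
  have h1 : ∀ (l : List Bool) (u : M × M → M), Continuous u →
      Continuous fun p : M × M => (l.map fun b => cond b p.1 p.2).foldl
        (fun v a => H.bracket v a) (u p) := by
    intro l
    induction l with
    | nil => exact fun u hu => hu
    | cons b l ih =>
      intro u hu
      refine ih (fun p => H.bracket (u p) (cond b p.1 p.2)) ?_
      cases b
      · exact (H.bracket.continuous.comp hu).clm_apply continuous_snd
      · exact (H.bracket.continuous.comp hu).clm_apply continuous_fst
  have h2 : ∀ l : List Bool,
      Continuous fun p : M × M => H.iterBracket (l.map fun b => cond b p.1 p.2) := by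
    intro l
    cases l with
    | nil => exact continuous_const
    | cons b l =>
      refine h1 l (fun p => cond b p.1 p.2) ?_
      cases b
      · exact continuous_snd
      · exact continuous_fst
  simp only [mul, dynkinPoly_eq]
  refine (continuous_fst.add continuous_snd).add (continuous_finsetSum _ fun m _ =>
    continuous_finsetSum _ fun k _ => continuous_finsetSum _ fun c _ => (h2 _).const_smul _)

variable {α : Type*} [TopologicalSpace α]

theorem _root_.Continuous.homMul {u v : α → M} (hu : Continuous u) (hv : Continuous v) :
    Continuous fun a => H.mul (u a) (v a) :=
  H.continuous_mul'.comp (hu.prodMk hv)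

/-- The projections onto the layers are continuous, by the open mapping theorem. -/
theorem continuous_proj [CompleteSpace M] (i : ℕ) : Continuous (H.proj i) := by
  by_cases hi : i = 0 ∨ H.step < i
  · have : H.proj i = fun _ => 0 := funext fun x => H.proj_eq_zero hi x
    rw [this]
    exact continuous_const
  have : ∀ i, CompleteSpace (H.layer i) := fun i => (H.isClosed_layer i).completeSpace_coe
  let e : (∀ i : Fin (H.step + 1), H.layer i) ≃ₗ[ℝ] M :=
    { toFun := fun s => ∑ i, (s i : M)
      map_add' := fun s s' => by simp [Finset.sum_add_distrib]
      map_smul' := fun r s => by simp [Finset.smul_sum]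
      invFun := fun x i => ⟨H.proj i x, H.proj_mem i x⟩
      left_inv := fun s => by
        funext i
        apply Subtype.ext
        change H.projL i (∑ j, (s j : M)) = s i
        rw [map_sum, Finset.sum_eq_single i]
        · exact H.proj_self (s i).2
        · intro j _ hj
          rw [projL_apply, H.proj_of_mem (s j).2, if_neg]
          exact fun h => hj (Fin.ext h.symm)
        · simp
      right_inv := fun x => by
        change ∑ i : Fin (H.step + 1), H.proj i x = x
        rw [Fin.sum_univ_eq_sum_range (fun i => H.proj i x), Finset.sum_range_succ',
          H.proj_eq_zero (Or.inl rfl), add_zero]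
        conv_rhs => rw [← H.sum_proj x]
        have : Finset.Icc 1 H.step = Finset.Ico 1 (H.step + 1) := by ext; simp
        rw [this, Finset.sum_Ico_eq_sum_range, Nat.add_sub_cancel]
        simp only [add_comm] }
  have he : Continuous e := by
    change Continuous fun s : ∀ i : Fin (H.step + 1), H.layer i => ∑ i, (s i : M)
    exact continuous_finsetSum _ fun i _ => continuous_subtype_val.comp (continuous_apply i)
  have hs : Continuous e.symm := (e.toContinuousLinearEquivOfContinuous he).symm.continuous
  exact continuous_subtype_val.comp ((continuous_apply (⟨i, by omega⟩ : Fin (H.step + 1))).comp hs)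

theorem _root_.Continuous.homDil [CompleteSpace M] {r : α → ℝ} {u : α → M} (hr : Continuous r)
    (hu : Continuous u) : Continuous fun a => H.dil (r a) (u a) :=
  continuous_finsetSum _ fun i _ => (hr.pow i).smul ((H.continuous_proj i).comp hu)

end Continuity

end BanachHomogeneousGroup

/-! ### Homogeneous distances on stratified groups -/

namespace BanachHomogeneousGroup

section Gauge

variable {E : Type*} [NormedAddCommGroup E] [NormedSpace ℝ E] {G : BanachHomogeneousGroup E}

namespace HomogeneousDistance

variable (D : G.HomogeneousDistance)

/-- The distance from the identity element. -/
def gauge (x : E) : ℝ := D.d 0 x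

theorem gauge_zero : D.gauge 0 = 0 := (D.eq_zero_iff 0 0).2 rfl

theorem d_eq_gauge (x y : E) : D.d x y = D.gauge (G.mul (-x) y) := by
  rw [gauge, ← D.mul_left (-x) x y, neg_mul_self]

theorem d_nonneg (x y : E) : 0 ≤ D.d x y := by
  have h := D.triangle x y x
  rw [(D.eq_zero_iff x x).2 rfl, D.symm y x] at h
  linarith

theorem gauge_nonneg (x : E) : 0 ≤ D.gauge x := D.d_nonneg 0 x

theorem gauge_pos {x : E} (hx : x ≠ 0) : 0 < D.gauge x :=
  (D.gauge_nonneg x).lt_of_ne' fun h => hx ((D.eq_zero_iff 0 x).1 h).symm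

theorem d_mul_right (x y : E) : D.d x (G.mul x y) = D.gauge y := by
  rw [d_eq_gauge, neg_mul_cancel_left]

theorem gauge_neg (x : E) : D.gauge (-x) = D.gauge x := by
  rw [← D.d_mul_right x, mul_neg_self, D.symm, gauge]

theorem gauge_mul_le (x y : E) : D.gauge (G.mul x y) ≤ D.gauge x + D.gauge y := by
  have h := D.triangle 0 x (G.mul x y)
  rwa [d_mul_right] at h

theorem gauge_dil {r : ℝ} (hr : 0 < r) (x : E) : D.gauge (G.dil r x) = r * D.gauge x := by
  have := D.dil r hr 0 x
  rwa [dil_zero] at this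

theorem gauge_comm_le (x y : E) : D.gauge (G.comm x y) ≤ 2 * D.gauge x + 2 * D.gauge y := by
  have h1 := D.gauge_mul_le (G.mul x y) (-G.mul y x)
  rw [gauge_neg] at h1
  have h2 := D.gauge_mul_le x y
  have h3 := D.gauge_mul_le y x
  rw [comm]
  linarith

theorem gauge_smul_le {x : E} (hx : x ∈ G.layer 1) {t : ℝ} (ht : |t| ≤ 1) :
    D.gauge (t • x) ≤ D.gauge x := by
  have h : ∀ s : ℝ, 0 < s → s ≤ 1 → D.gauge (s • x) ≤ D.gauge x := by
    intro s hs hs1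
    have : G.dil s x = s • x := by rw [dil_eq_scale, G.scale_of_mem _ hx, pow_one]
    rw [← this, D.gauge_dil hs]
    exact mul_le_of_le_one_left (D.gauge_nonneg x) hs1
  rcases lt_trichotomy t 0 with h0 | h0 | h0
  · rw [← D.gauge_neg, ← neg_smul]
    exact h _ (neg_pos.2 h0) (by rwa [abs_of_neg h0] at ht)
  · rw [h0, zero_smul, gauge_zero]
    exact D.gauge_nonneg x
  · exact h t h0 (by rwa [abs_of_pos h0] at ht)

/-- The multiples `t b`, `|t| ≤ 1`, of `b` are the leading terms, in the layer `H_j`, of group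
elements which are bounded both in norm and in gauge. -/
def Reachable (j : ℕ) (b : E) : Prop :=
  ∃ C : ℝ, ∀ t : ℝ, |t| ≤ 1 → ∃ g ∈ G.filt j, G.proj j g = t • b ∧ ‖g‖ ≤ C ∧ D.gauge g ≤ C

theorem exists_norm_mul_le [FiniteDimensional ℝ E] (G : BanachHomogeneousGroup E) (C : ℝ) :
    ∃ C', ∀ x y, ‖x‖ ≤ C → ‖y‖ ≤ C → ‖G.mul x y‖ ≤ C' := by
  have : ProperSpace E := FiniteDimensional.proper ℝ E
  have hK : IsCompact (Metric.closedBall (0 : E) C ×ˢ Metric.closedBall (0 : E) C) :=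
    (isCompact_closedBall _ _).prod (isCompact_closedBall _ _)
  obtain ⟨C', hC'⟩ := (hK.image G.continuous_mul').isBounded.exists_norm_le
  refine ⟨C', fun x y hx hy => hC' _ ⟨(x, y), ⟨?_, ?_⟩, rfl⟩⟩ <;> simpa

theorem exists_norm_dil_le [FiniteDimensional ℝ E] (G : BanachHomogeneousGroup E) (r C : ℝ) :
    ∃ C', ∀ x, ‖x‖ ≤ C → ‖G.dil r x‖ ≤ C' := by
  have : ProperSpace E := FiniteDimensional.proper ℝ E
  have : CompleteSpace E := FiniteDimensional.complete ℝ E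
  obtain ⟨C', hC'⟩ := ((isCompact_closedBall (0 : E) C).image
    (Continuous.homDil G (continuous_const (y := r)) continuous_id)).isBounded.exists_norm_le
  exact ⟨C', fun x hx => hC' _ ⟨x, by simpa, rfl⟩⟩

namespace Reachable

variable [FiniteDimensional ℝ E] {D}

theorem add {j : ℕ} {b b' : E} (hb : D.Reachable j b) (hb' : D.Reachable j b') :
    D.Reachable j (b + b') := by
  obtain ⟨C, hC⟩ := hb
  obtain ⟨C', hC'⟩ := hb'
  obtain ⟨K, hK⟩ := exists_norm_mul_le G (max C C')
  refine ⟨max K (C + C'), fun t ht => ?_⟩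
  obtain ⟨g, hg, hgb, hgn, hgg⟩ := hC t ht
  obtain ⟨g', hg', hgb', hgn', hgg'⟩ := hC' t ht
  refine ⟨G.mul g g', G.mul_mem_filt hg hg', ?_, ?_, ?_⟩
  · rw [G.proj_mul_of_mem_filt hg hg', hgb, hgb', smul_add]
  · exact (hK _ _ (hgn.trans (le_max_left _ _)) (hgn'.trans (le_max_right _ _))).trans
      (le_max_left _ _)
  · exact ((D.gauge_mul_le g g').trans (add_le_add hgg hgg')).trans (le_max_right _ _)

theorem smul {j : ℕ} (hj : 1 ≤ j) {b : E} (hb : D.Reachable j b) (r : ℝ) :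
    D.Reachable j (r • b) := by
  obtain ⟨C, hC⟩ := hb
  -- a dilation by `ρ ≥ 1` with `ρ ^ j ≥ |r|` reduces to multiples with coefficient at most one
  set ρ : ℝ := max 1 |r| with hρ
  have hρ1 : 1 ≤ ρ := le_max_left _ _
  have hρr : |r| ≤ ρ ^ j := (le_max_right _ _).trans (le_self_pow₀ hρ1 (by omega))
  have hρ0 : 0 < ρ := by linarith
  obtain ⟨K, hK⟩ := exists_norm_dil_le G ρ C
  refine ⟨max K (ρ * C), fun t ht => ?_⟩
  obtain ⟨g, hg, hgb, hgn, hgg⟩ := hC (t * r / ρ ^ j) (by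
    rw [abs_div, abs_mul, abs_of_pos (pow_pos hρ0 j), div_le_one (pow_pos hρ0 j)]
    calc |t| * |r| ≤ 1 * |r| := by gcongr
      _ ≤ ρ ^ j := by rwa [one_mul])
  refine ⟨G.dil ρ g, fun i hi => ?_, ?_, (hK g hgn).trans (le_max_left _ _), ?_⟩
  · rw [dil_eq_scale, proj_scale, hg i hi, smul_zero]
  · rw [dil_eq_scale, proj_scale, hgb, smul_smul, smul_smul]
    congr 1
    field_simp
  · rw [D.gauge_dil hρ0]
    exact (mul_le_mul_of_nonneg_left hgg hρ0.le).trans (le_max_right _ _)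

omit [FiniteDimensional ℝ E] in
theorem of_mem_layer_one {b : E} (hb : b ∈ G.layer 1) : D.Reachable 1 b := by
  refine ⟨max ‖b‖ (D.gauge b), fun t ht => ⟨t • b, G.mem_filt_one _, ?_, ?_, ?_⟩⟩
  · rw [proj_smul, G.proj_self hb]
  · rw [norm_smul]
    exact (mul_le_of_le_one_left (norm_nonneg b) ht).trans (le_max_left _ _)
  · exact (D.gauge_smul_le hb ht).trans (le_max_right _ _)

theorem _root_.BanachHomogeneousGroup.proj_bracket_of_mem_layer_one
    {M : Type*} [NormedAddCommGroup M] [NormedSpace ℝ M] (H : BanachHomogeneousGroup M)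
    {v : M} (hv : v ∈ H.layer 1) (j : ℕ) (x : M) :
    H.proj (j + 1) (H.bracket v x) = H.bracket v (H.proj j x) := by
  induction x using H.layer_induction with
  | h0 => simp
  | hadd x y hx hy => simp [hx, hy]
  | hl i x _ _ hx =>
    rw [H.proj_of_mem (H.bracket_mem 1 i v x hv hx), H.proj_of_mem hx]
    by_cases h : j = i
    · rw [if_pos h, if_pos (by omega)]
    · rw [if_neg h, if_neg (by omega), map_zero]

theorem bracket {j : ℕ} {v b : E} (hv : v ∈ G.layer 1) (hb : D.Reachable j b) :
    D.Reachable (j + 1) (G.bracket v b) := by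
  obtain ⟨C, hC⟩ := hb
  obtain ⟨K, hK⟩ := exists_norm_mul_le G (max ‖v‖ C)
  obtain ⟨K', hK'⟩ := exists_norm_mul_le G K
  refine ⟨max K' (2 * D.gauge v + 2 * C), fun t ht => ?_⟩
  obtain ⟨g, hg, hgb, hgn, hgg⟩ := hC t ht
  have hc := G.comm_sub_bracket_mem (x := v) hg
  have hbr : G.bracket v g ∈ G.filt (j + 1) := by
    rw [add_comm]
    exact G.bracket_mem_filt (G.mem_filt_one v) hg
  refine ⟨G.comm v g, ?_, ?_, ?_, ?_⟩
  · simpa using Submodule.add_mem _ (G.filt_anti (by omega) hc) hbr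
  · have := hc (j + 1) (by omega)
    rw [proj_sub, sub_eq_zero] at this
    rw [this, G.proj_bracket_of_mem_layer_one hv, hgb, map_smul]
  · have h1 := hK v g (le_max_left _ _) (hgn.trans (le_max_right _ _))
    have h2 := hK g v (hgn.trans (le_max_right _ _)) (le_max_left _ _)
    exact (hK' _ _ h1 (by rwa [norm_neg])).trans (le_max_left _ _)
  · exact ((D.gauge_comm_le v g).trans (by linarith)).trans (le_max_right _ _)

end Reachable

variable [FiniteDimensional ℝ E]

omit [FiniteDimensional ℝ E] in
theorem reachable_zero (j : ℕ) : D.Reachable j 0 :=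
  ⟨0, fun t _ => ⟨0, Submodule.zero_mem _, by simp, by simp, D.gauge_zero.le⟩⟩

/-- In a stratified group every vector of every layer is reachable: the layers are spanned by
iterated brackets of vectors of the first layer. -/
theorem reachable_of_mem_layer (hG : G.IsStratified) {j : ℕ} (hj : 1 ≤ j) :
    ∀ b ∈ G.layer j, D.Reachable j b := by
  induction j, hj using Nat.le_induction with
  | base => exact fun b hb => Reachable.of_mem_layer_one hb
  | succ j hj ih =>
    intro b hb
    rw [← hG.span_bracket j hj] at hb
    induction hb using Submodule.span_induction with
    | mem b hb =>
      obtain ⟨x, hx, y, hy, rfl⟩ := hb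
      exact (ih y hy).bracket hx
    | zero => exact D.reachable_zero _
    | add b b' _ _ hb hb' => exact hb.add hb'
    | smul r b _ hb => exact hb.smul (by omega) r

theorem exists_reachable_sum {j : ℕ} {ι : Type*} (s : Finset ι) (b : ι → E)
    (hb : ∀ i ∈ s, D.Reachable j (b i)) :
    ∃ C : ℝ, ∀ t : ι → ℝ, (∀ i, |t i| ≤ 1) →
      ∃ g ∈ G.filt j, G.proj j g = ∑ i ∈ s, t i • b i ∧ ‖g‖ ≤ C ∧ D.gauge g ≤ C := by
  classical
  induction s using Finset.induction_on with
  | empty => exact ⟨0, fun t _ => ⟨0, Submodule.zero_mem _, by simp, by simp, D.gauge_zero.le⟩⟩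
  | insert a s ha ih =>
    obtain ⟨C, hC⟩ := ih fun i hi => hb i (Finset.mem_insert_of_mem hi)
    obtain ⟨C', hC'⟩ := hb a (Finset.mem_insert_self a s)
    obtain ⟨K, hK⟩ := exists_norm_mul_le G (max C' C)
    refine ⟨max K (C' + C), fun t ht => ?_⟩
    obtain ⟨g, hg, hgb, hgn, hgg⟩ := hC' (t a) (ht a)
    obtain ⟨g', hg', hgb', hgn', hgg'⟩ := hC t ht
    refine ⟨G.mul g g', G.mul_mem_filt hg hg', ?_, ?_, ?_⟩
    · rw [G.proj_mul_of_mem_filt hg hg', hgb, hgb', Finset.sum_insert ha]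
    · exact (hK _ _ (hgn.trans (le_max_left _ _)) (hgn'.trans (le_max_right _ _))).trans
        (le_max_left _ _)
    · exact ((D.gauge_mul_le g g').trans (add_le_add hgg hgg')).trans (le_max_right _ _)

/-- The leading terms in a bounded part of the layer `H_j` are attained by group elements which
are uniformly bounded in norm and in gauge. -/
theorem exists_reachable_ball (hG : G.IsStratified) {j : ℕ} (hj : 1 ≤ j) (R : ℝ) :
    ∃ C : ℝ, ∀ b ∈ G.layer j, ‖b‖ ≤ R →
      ∃ g ∈ G.filt j, G.proj j g = b ∧ ‖g‖ ≤ C ∧ D.gauge g ≤ C := by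
  set β := Module.finBasis ℝ (G.layer j)
  set K : ℝ := ∑ i, ‖(β.coord i).toContinuousLinearMap‖ with hK
  have hK0 : 0 ≤ K := Finset.sum_nonneg fun i _ => ContinuousLinearMap.opNorm_nonneg _
  set S : ℝ := K * |R| + 1 with hS
  have hS0 : 0 < S := by positivity
  obtain ⟨C, hC⟩ := D.exists_reachable_sum Finset.univ (fun i => S • (β i : E))
    fun i _ => (D.reachable_of_mem_layer hG hj _ (β i).2).smul hj S
  refine ⟨C, fun b hb hbR => ?_⟩
  obtain ⟨g, hg, hgb, h⟩ := hC (fun i => β.repr ⟨b, hb⟩ i / S) fun i => by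
    rw [abs_div, abs_of_pos hS0, div_le_one hS0]
    have h1 := (β.coord i).toContinuousLinearMap.le_opNorm ⟨b, hb⟩
    have h2 : ‖(β.coord i).toContinuousLinearMap‖ ≤ K :=
      Finset.single_le_sum (f := fun i => ‖(β.coord i).toContinuousLinearMap‖)
        (fun _ _ => ContinuousLinearMap.opNorm_nonneg _) (Finset.mem_univ i)
    calc |β.repr ⟨b, hb⟩ i| ≤ ‖(β.coord i).toContinuousLinearMap‖ * ‖b‖ := h1
      _ ≤ K * |R| := by gcongr; exact hbR.trans (le_abs_self R)
      _ ≤ S := by linarith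
  refine ⟨g, hg, ?_, h⟩
  rw [hgb]
  have := congrArg Subtype.val (β.sum_repr ⟨b, hb⟩)
  simp only [Submodule.coe_sum, Submodule.coe_smul] at this
  conv_rhs => rw [← this]
  refine Finset.sum_congr rfl fun i _ => ?_
  rw [smul_smul, div_mul_cancel₀ _ hS0.ne']

/-- The gauge is bounded on bounded subsets of `filt j`, by downward induction on `j`: dividing by
a reachable element with the same leading term leads from `filt j` to `filt (j + 1)`. -/
theorem exists_gauge_le_of_mem_filt (hG : G.IsStratified) {j : ℕ} (hj1 : 1 ≤ j)
    (hj : j ≤ G.step + 1) :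
    ∀ R : ℝ, ∃ C : ℝ, ∀ x ∈ G.filt j, ‖x‖ ≤ R → D.gauge x ≤ C := by
  have : CompleteSpace E := FiniteDimensional.complete ℝ E
  induction hj using Nat.decreasingInduction with
  | self =>
    refine fun R => ⟨0, fun x hx _ => ?_⟩
    rw [G.eq_zero_of_mem_filt (Nat.lt_succ_self _) hx, gauge_zero]
  | of_succ j hj ih =>
    intro R
    have ih := ih (by omega)
    set K := ‖(G.projL j).toContinuousLinearMap‖ with hK
    obtain ⟨C, hC⟩ := D.exists_reachable_ball hG hj1 (K * R)
    obtain ⟨C', hC'⟩ := exists_norm_mul_le G (max C R)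
    obtain ⟨C'', hC''⟩ := ih C'
    refine ⟨C + C'', fun x hx hxR => ?_⟩
    obtain ⟨g, hg, hgb, hgn, hgg⟩ := hC (G.proj j x) (G.proj_mem j x)
      (((G.projL j).toContinuousLinearMap.le_opNorm x).trans (by gcongr))
    have hg' : -g ∈ G.filt j := Submodule.neg_mem _ hg
    have h1 : G.mul (-g) x ∈ G.filt (j + 1) := by
      rw [mem_filt_succ_iff]
      refine ⟨G.mul_mem_filt hg' hx, ?_⟩
      rw [G.proj_mul_of_mem_filt hg' hx, proj_neg, hgb, neg_add_cancel]
    have h2 := hC'' _ h1 (hC' _ _ (by rw [norm_neg]; exact hgn.trans (le_max_left _ _))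
      (hxR.trans (le_max_right _ _)))
    have h3 := D.gauge_mul_le g (G.mul (-g) x)
    rw [mul_neg_cancel_left] at h3
    linarith

/-- The gauge is bounded on bounded sets. -/
theorem exists_gauge_le (hG : G.IsStratified) (R : ℝ) :
    ∃ C : ℝ, ∀ x : E, ‖x‖ ≤ R → D.gauge x ≤ C := by
  obtain ⟨C, hC⟩ := D.exists_gauge_le_of_mem_filt hG le_rfl (by omega) R
  exact ⟨C, fun x => hC x (G.mem_filt_one x)⟩

theorem tendsto_gauge_zero (hG : G.IsStratified) : Tendsto D.gauge (𝓝 0) (𝓝 0) := by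
  have : CompleteSpace E := FiniteDimensional.complete ℝ E
  obtain ⟨C, hC⟩ := D.exists_gauge_le hG 1
  have hC0 : 0 ≤ C := (D.gauge_nonneg 0).trans (hC 0 (by simp))
  rw [Metric.tendsto_nhds]
  intro ε hε
  set r : ℝ := ε / (C + 1) with hr
  have hr0 : 0 < r := by positivity
  have hcont : Tendsto (fun x => G.dil r⁻¹ x) (𝓝 0) (𝓝 0) := by
    have := (Continuous.homDil G (continuous_const (y := r⁻¹)) continuous_id).tendsto (0 : E)
    simpa [dil_zero] using this
  filter_upwards [hcont (Metric.closedBall_mem_nhds (0 : E) one_pos)] with x hx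
  have h1 : ‖G.dil r⁻¹ x‖ ≤ 1 := by simpa using hx
  have h2 : D.gauge x = r * D.gauge (G.dil r⁻¹ x) := by
    rw [← D.gauge_dil hr0, dil_dil, mul_inv_cancel₀ hr0.ne', dil_one]
  rw [Real.dist_eq, sub_zero, abs_of_nonneg (D.gauge_nonneg x), h2]
  calc r * D.gauge (G.dil r⁻¹ x) ≤ r * C := by gcongr; exact hC _ h1
    _ < r * (C + 1) := by gcongr; linarith
    _ = ε := by rw [hr]; field_simp

theorem continuous_gauge (hG : G.IsStratified) : Continuous D.gauge := by
  rw [continuous_iff_continuousAt]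
  intro x
  have h1 : Tendsto (fun y => D.gauge (G.mul (-x) y)) (𝓝 x) (𝓝 0) := by
    refine (D.tendsto_gauge_zero hG).comp ?_
    have := (Continuous.homMul G (continuous_const (y := -x)) continuous_id).tendsto x
    simpa [neg_mul_self] using this
  rw [ContinuousAt, tendsto_iff_dist_tendsto_zero]
  refine squeeze_zero (fun _ => dist_nonneg) (fun y => ?_) h1
  rw [Real.dist_eq, abs_sub_le_iff, ← d_eq_gauge]
  have h2 := D.triangle 0 x y
  have h3 := D.triangle 0 y x
  rw [D.symm y x] at h3
  simp only [gauge]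
  constructor <;> linarith

theorem _root_.Continuous.homogeneousDistance {α : Type*} [TopologicalSpace α]
    (hG : G.IsStratified) {u v : α → E} (hu : Continuous u) (hv : Continuous v) :
    Continuous fun a => D.d (u a) (v a) := by
  simp only [d_eq_gauge]
  exact (D.continuous_gauge hG).comp (Continuous.homMul G hu.neg hv)

/-- Elements of small gauge are small in norm: otherwise a dilation moves them to a fixed sphere,
on which the gauge is bounded below by compactness. -/
theorem exists_norm_lt (hG : G.IsStratified) {ε : ℝ} (hε : 0 < ε) :
    ∃ δ > 0, ∀ x : E, D.gauge x < δ → ‖x‖ < ε := by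
  have : ProperSpace E := FiniteDimensional.proper ℝ E
  have : CompleteSpace E := FiniteDimensional.complete ℝ E
  obtain ⟨δ, hδ, hsph⟩ : ∃ δ > 0, ∀ x ∈ Metric.sphere (0 : E) ε, δ ≤ D.gauge x := by
    rcases (Metric.sphere (0 : E) ε).eq_empty_or_nonempty with h | h
    · exact ⟨1, one_pos, by simp [h]⟩
    · obtain ⟨x, hx, hmin⟩ := (isCompact_sphere (0 : E) ε).exists_isMinOn h
        (D.continuous_gauge hG).continuousOn
      refine ⟨D.gauge x, D.gauge_pos ?_, fun y hy => hmin hy⟩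
      rintro rfl
      simp at hx
      linarith
  refine ⟨δ, hδ, fun x hx => ?_⟩
  by_contra! hcon
  have hc : ContinuousOn (fun r : ℝ => ‖G.dil r x‖) (Set.Icc 0 1) :=
    (Continuous.homDil G continuous_id continuous_const).norm.continuousOn
  have h0 : G.dil 0 x = 0 := by
    rw [BanachHomogeneousGroup.dil]
    refine Finset.sum_eq_zero fun i hi => ?_
    rw [zero_pow (by have := (Finset.mem_Icc.mp hi).1; omega), zero_smul]
  obtain ⟨r, hr, hrx⟩ := intermediate_value_Icc zero_le_one hc
    (show ε ∈ Set.Icc ‖G.dil 0 x‖ ‖G.dil 1 x‖ by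
      rw [h0, norm_zero, dil_one]; exact ⟨hε.le, hcon⟩)
  have hr0 : 0 < r := by
    refine hr.1.lt_of_ne ?_
    rintro rfl
    simp only [h0, norm_zero] at hrx
    linarith
  have h1 := hsph (G.dil r x) (by simpa using hrx)
  rw [D.gauge_dil hr0] at h1
  have h2 := mul_le_of_le_one_left (D.gauge_nonneg x) hr.2
  linarith

/-- Sets which are bounded in gauge are bounded in norm. -/
theorem exists_norm_le (hG : G.IsStratified) (R : ℝ) :
    ∃ C : ℝ, ∀ x : E, D.gauge x ≤ R → ‖x‖ ≤ C := by
  obtain ⟨δ, hδ, h⟩ := D.exists_norm_lt hG one_pos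
  set S : ℝ := |R| + 1 with hS
  have hS0 : 0 < S := by positivity
  have hRS : R < S := by have := le_abs_self R; linarith
  obtain ⟨C, hC⟩ := exists_norm_dil_le G (S / δ) 1
  refine ⟨C, fun x hx => ?_⟩
  have h1 : ‖G.dil (δ / S) x‖ < 1 := by
    apply h
    rw [D.gauge_dil (by positivity), div_mul_eq_mul_div, div_lt_iff₀ hS0]
    gcongr
    linarith
  have h2 := hC _ h1.le
  rwa [dil_dil, div_mul_div_cancel₀ hδ.ne', div_self hS0.ne', dil_one] at h2

end HomogeneousDistance

end Gauge

end BanachHomogeneousGroup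

/-! ### Directions at density points -/

theorem tendsto_const_mul_nhdsGT_zero {a : ℝ} (ha : 0 < a) :
    Tendsto (fun t : ℝ => a * t) (𝓝[>] 0) (𝓝[>] 0) := by
  refine tendsto_nhdsWithin_iff.2 ⟨?_, ?_⟩
  · have := (continuous_const_mul a).tendsto 0
    rw [mul_zero] at this
    exact this.mono_left nhdsWithin_le_nhds
  · filter_upwards [self_mem_nhdsWithin] with t ht
    exact mul_pos ha ht

namespace BanachHomogeneousGroup

namespace HomogeneousDistance

variable {E : Type*} [NormedAddCommGroup E] [NormedSpace ℝ E] [FiniteDimensional ℝ E]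
  {G : BanachHomogeneousGroup E} (D : G.HomogeneousDistance)

theorem isOpen_ball (hG : G.IsStratified) (x : E) (r : ℝ) : IsOpen (D.ball x r) :=
  isOpen_lt (Continuous.homogeneousDistance D hG continuous_const continuous_id) continuous_const

theorem isCompact_gauge_le (hG : G.IsStratified) (R : ℝ) : IsCompact {x | D.gauge x ≤ R} := by
  have : ProperSpace E := FiniteDimensional.proper ℝ E
  obtain ⟨C, hC⟩ := D.exists_norm_le hG R
  refine (isCompact_closedBall (0 : E) C).of_isClosed_subset
    (isClosed_le (D.continuous_gauge hG) continuous_const) fun x hx => ?_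
  simpa using hC x hx

omit [FiniteDimensional ℝ E] in
theorem mem_ball_self {x : E} {r : ℝ} (hr : 0 < r) : x ∈ D.ball x r := by
  change D.d x x < r
  rwa [(D.eq_zero_iff x x).2 rfl]

/-- A ball is covered by a fixed number of balls whose radius is a fixed fraction of its own. -/
theorem exists_cover (hG : G.IsStratified) {ε : ℝ} (hε : 0 < ε) (R : ℝ) :
    ∃ s : Finset E, ∀ t : ℝ, 0 < t → D.ball 0 (R * t) ⊆ ⋃ y ∈ s, D.ball (G.dil t y) (ε * t) := by
  obtain ⟨s, hs⟩ := (D.isCompact_gauge_le hG R).elim_finite_subcover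
    (fun y : E => D.ball y ε) (fun y => D.isOpen_ball hG y ε)
    fun x _ => Set.mem_iUnion.2 ⟨x, D.mem_ball_self hε⟩
  refine ⟨s, fun t ht x hx => ?_⟩
  have hxt : x = G.dil t (G.dil t⁻¹ x) := by rw [dil_dil, mul_inv_cancel₀ ht.ne', dil_one]
  have h1 : D.gauge (G.dil t⁻¹ x) ≤ R := by
    have h2 : D.gauge x < R * t := hx
    rw [D.gauge_dil (by positivity), inv_mul_le_iff₀ ht]
    linarith
  obtain ⟨y, hy, hxy⟩ := Set.mem_iUnion₂.1 (hs h1)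
  refine Set.mem_iUnion₂.2 ⟨y, hy, ?_⟩
  change D.d _ x < _
  rw [hxt, D.dil t ht, mul_comm ε]
  exact mul_lt_mul_of_pos_left hxy ht

variable [MeasurableSpace E] [BorelSpace E] {μ : Measure E}

theorem measure_ball_eq (hG : G.IsStratified) (hμ : G.IsHaar μ) (x : E) (r : ℝ) :
    μ (D.ball x r) = μ (D.ball 0 r) := by
  have hcont : Continuous (G.mul x) := Continuous.homMul G continuous_const continuous_id
  conv_lhs => rw [← hμ.map_mul_left x]
  rw [Measure.map_apply hcont.measurable (D.isOpen_ball hG x r).measurableSet]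
  congr 1
  ext y
  change D.d x (G.mul x y) < r ↔ D.d 0 y < r
  rw [d_mul_right, gauge]

theorem measure_ball_ne_top (hG : G.IsStratified) (hμ : G.IsHaar μ) (x : E) (r : ℝ) :
    μ (D.ball x r) ≠ ⊤ := by
  have := hμ.finite_on_compacts
  rw [D.measure_ball_eq hG hμ]
  refine ne_top_of_le_ne_top (D.isCompact_gauge_le hG r).measure_lt_top.ne (measure_mono ?_)
  exact fun y hy => le_of_lt (show D.gauge y < r from hy)

omit [BorelSpace E] in
theorem measure_ball_pos (hG : G.IsStratified) (hμ : G.IsHaar μ) (x : E) {r : ℝ} (hr : 0 < r) :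
    0 < μ (D.ball x r) := by
  have := hμ.open_pos
  exact (D.isOpen_ball hG x r).measure_pos μ ⟨x, D.mem_ball_self hr⟩

/-- Near a density point `x` of `A`, the points `x δ_t ζ` are approximated by `A` up to `o(t)`. -/
theorem eventually_exists_near (hG : G.IsStratified) (hμ : G.IsHaar μ) {A : Set E} {x : E}
    (hx : IsDensityPoint D μ A x) (ζ : E) {ε : ℝ} (hε : 0 < ε) :
    ∀ᶠ t in 𝓝[>] (0 : ℝ), ∃ q, G.mul x q ∈ A ∧ D.d q (G.dil t ζ) < ε * t := by
  set R : ℝ := D.gauge ζ + ε with hR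
  have hR0 : 0 < R := add_pos_of_nonneg_of_pos (D.gauge_nonneg ζ) hε
  obtain ⟨s, hs⟩ := D.exists_cover hG hε R
  have hcard : ∀ t, 0 < t → ∀ y z, μ (D.ball y (R * t)) ≤ s.card * μ (D.ball z (ε * t)) := by
    intro t ht y z
    rw [D.measure_ball_eq hG hμ y, D.measure_ball_eq hG hμ z]
    refine (measure_mono (hs t ht)).trans ((measure_biUnion_finset_le _ _).trans ?_)
    simp [D.measure_ball_eq hG hμ (G.dil t _)]
  have hlim : Tendsto (fun t : ℝ => μ (A ∩ D.ball x (R * t)) / μ (D.ball x (R * t)))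
      (𝓝[>] 0) (𝓝 1) := hx.comp (tendsto_const_mul_nhdsGT_zero hR0)
  have hlt : 1 - (s.card : ENNReal)⁻¹ < 1 :=
    ENNReal.sub_lt_self ENNReal.one_ne_top one_ne_zero (by simp)
  filter_upwards [hlim.eventually (lt_mem_nhds hlt), self_mem_nhdsWithin] with t h1 ht
  have ht : 0 < t := ht
  by_contra! hcon
  -- otherwise `A` misses a ball of proportional radius contained in `B(x, R t)`
  set B := D.ball x (R * t) with hB
  set B' := D.ball (G.mul x (G.dil t ζ)) (ε * t) with hB'
  have hsub : B' ⊆ B := by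
    intro y hy
    have h2 := D.triangle x (G.mul x (G.dil t ζ)) y
    rw [d_mul_right, D.gauge_dil ht] at h2
    have h3 : D.d (G.mul x (G.dil t ζ)) y < ε * t := hy
    change D.d x y < R * t
    rw [hR]
    linarith
  have hdisj : Disjoint (A ∩ B) B' := by
    rw [Set.disjoint_left]
    rintro y ⟨hyA, -⟩ hy
    have h2 := hcon (G.mul (-x) y) (by rwa [mul_neg_cancel_left])
    rw [← D.mul_left x, mul_neg_cancel_left, D.symm] at h2
    exact absurd hy (not_lt.2 h2)
  have hadd : μ (A ∩ B) + μ B' ≤ μ B := by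
    rw [← measure_union hdisj (D.isOpen_ball hG _ _).measurableSet]
    exact measure_mono (Set.union_subset Set.inter_subset_right hsub)
  have hB0 : μ B ≠ 0 := (D.measure_ball_pos hG hμ x (mul_pos hR0 ht)).ne'
  have hBt : μ B ≠ ⊤ := D.measure_ball_ne_top hG hμ x _
  have hB'B : (s.card : ENNReal)⁻¹ ≤ μ B' / μ B := by
    rw [ENNReal.le_div_iff_mul_le (Or.inl hB0) (Or.inl hBt)]
    rcases Nat.eq_zero_or_pos s.card with h0 | h0
    · have := hcard t ht x x
      rw [h0, Nat.cast_zero, zero_mul, nonpos_iff_eq_zero] at this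
      exact absurd this hB0
    · rw [mul_comm, ← div_eq_mul_inv]
      exact ENNReal.div_le_of_le_mul (by rw [mul_comm]; exact hcard t ht _ _)
  have h4 : μ (A ∩ B) / μ B + (s.card : ENNReal)⁻¹ ≤ 1 := by
    refine (add_le_add le_rfl hB'B).trans ?_
    rw [← ENNReal.add_div]
    exact ENNReal.div_le_of_le_mul (by rwa [one_mul])
  have h5 : μ (A ∩ B) / μ B ≤ 1 - (s.card : ENNReal)⁻¹ := by
    refine ENNReal.le_sub_of_add_le_right ?_ h4
    intro htop
    rw [htop, add_top] at h4
    exact absurd h4 (by simp)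
  exact absurd h1 (not_lt.2 h5)

/-- Every direction can be approximated in `A` at a density point of `A`. -/
theorem exists_approximates (hG : G.IsStratified) (hμ : G.IsHaar μ) {A : Set E} {x : E}
    (hxA : x ∈ A) (hx : IsDensityPoint D μ A x) (ζ : E) : ∃ p, Approximates D A x ζ p := by
  have hex : ∀ t : ℝ, ∃ q, G.mul x q ∈ A ∧ (0 < t → ∀ q', G.mul x q' ∈ A →
      D.d q (G.dil t ζ) ≤ D.d q' (G.dil t ζ) + t ^ 2) := by
    intro t
    by_cases ht : 0 < t
    · set S := (fun q => D.d q (G.dil t ζ)) '' {q | G.mul x q ∈ A} with hS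
      have hbdd : BddBelow S := ⟨0, by rintro _ ⟨q, -, rfl⟩; exact D.d_nonneg _ _⟩
      have hne : S.Nonempty := ⟨_, 0, by rwa [Set.mem_ofPred_eq, mul_zero'], rfl⟩
      obtain ⟨_, ⟨q, hq, rfl⟩, hlt⟩ := exists_lt_of_csInf_lt hne
        (show sInf S < sInf S + t ^ 2 by have : 0 < t ^ 2 := by positivity
                                         linarith)
      refine ⟨q, hq, fun _ q' hq' => ?_⟩
      have := csInf_le hbdd ⟨q', hq', rfl⟩
      simp only at hlt this
      linarith
    · exact ⟨0, by rwa [mul_zero'], fun h => absurd h ht⟩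
  choose p hpA hp using hex
  refine ⟨p, fun t _ => hpA t, ?_⟩
  rw [Metric.tendsto_nhds]
  intro ε hε
  have hsmall : ∀ᶠ t in 𝓝[>] (0 : ℝ), t < ε / 2 :=
    nhdsWithin_le_nhds (gt_mem_nhds (by positivity))
  filter_upwards [D.eventually_exists_near hG hμ hx ζ (half_pos hε), hsmall,
    self_mem_nhdsWithin] with t ⟨q, hq, hqd⟩ hts ht
  have ht : 0 < t := ht
  rw [Real.dist_eq, sub_zero, abs_of_nonneg (div_nonneg (D.d_nonneg _ _) ht.le),
    div_lt_iff₀ ht]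
  have := hp t ht q hq
  nlinarith

end HomogeneousDistance

end BanachHomogeneousGroup

/-! ### The distance of a Banach homogeneous norm -/

namespace BanachHomogeneousGroup

namespace HomogeneousNorm

variable {M : Type*} [NormedAddCommGroup M] [NormedSpace ℝ M] {H : BanachHomogeneousGroup M}
  (N : H.HomogeneousNorm)

theorem homNorm_nonneg (x : M) : 0 ≤ H.homNorm N.σ x :=
  Real.iSup_nonneg fun i => mul_nonneg (N.σ_pos _ (by omega) (by omega)).le (by positivity)

theorem le_homNorm (x : M) (i : Fin H.step) :
    N.σ (i + 1) * ‖H.proj (i + 1) x‖ ^ (1 / ((i : ℝ) + 1)) ≤ H.homNorm N.σ x :=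
  le_ciSup (f := fun i : Fin H.step => N.σ (i + 1) * ‖H.proj (i + 1) x‖ ^ (1 / ((i : ℝ) + 1)))
    (Set.finite_range _).bddAbove i

theorem homNorm_neg (x : M) : H.homNorm N.σ (-x) = H.homNorm N.σ x := by
  simp [homNorm]

theorem homNorm_dil {r : ℝ} (hr : 0 < r) (x : M) :
    H.homNorm N.σ (H.dil r x) = r * H.homNorm N.σ x := by
  rw [homNorm, homNorm, Real.mul_iSup_of_nonneg hr.le]
  congr 1
  funext i
  rw [dil_eq_scale, proj_scale, norm_smul, Real.mul_rpow (norm_nonneg _) (norm_nonneg _),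
    Real.norm_of_nonneg (by positivity)]
  have : (r ^ ((i : ℕ) + 1)) ^ (1 / ((i : ℝ) + 1)) = r := by
    rw [one_div]
    exact_mod_cast Real.pow_rpow_inv_natCast hr.le (Nat.succ_ne_zero i)
  rw [this]
  ring

theorem tendsto_homNorm_zero [CompleteSpace M] : Tendsto (H.homNorm N.σ) (𝓝 0) (𝓝 0) := by
  set S : M → ℝ := fun x =>
    ∑ i : Fin H.step, N.σ (i + 1) * ‖H.proj (i + 1) x‖ ^ (1 / ((i : ℝ) + 1)) with hS
  have hcont : Continuous S := continuous_finsetSum _ fun i _ => continuous_const.mul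
    ((Real.continuous_rpow_const (by positivity)).comp (H.continuous_proj _).norm)
  have h0 : S 0 = 0 := by
    refine Finset.sum_eq_zero fun i _ => ?_
    rw [proj_zero, norm_zero, Real.zero_rpow (by positivity), mul_zero]
  have hpos : ∀ x, ∀ i : Fin H.step,
      0 ≤ N.σ (i + 1) * ‖H.proj (i + 1) x‖ ^ (1 / ((i : ℝ) + 1)) := fun x i =>
    mul_nonneg (N.σ_pos _ (by omega) (by omega)).le (by positivity)
  have hlim := hcont.tendsto 0
  rw [h0] at hlim
  refine squeeze_zero N.homNorm_nonneg (fun x => ?_) hlim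
  exact Real.iSup_le (fun i => Finset.single_le_sum (fun i _ => hpos x i) (Finset.mem_univ i))
    (Finset.sum_nonneg fun i _ => hpos x i)

/-- Convergence to the identity in the homogeneous norm implies convergence in norm. -/
theorem tendsto_zero_of_homNorm {α : Type*} {l : Filter α} {u : α → M}
    (hu : Tendsto (fun a => H.homNorm N.σ (u a)) l (𝓝 0)) : Tendsto u l (𝓝 0) := by
  have h1 : ∀ i ∈ Finset.Icc 1 H.step, Tendsto (fun a => H.proj i (u a)) l (𝓝 0) := by
    intro i hi
    obtain ⟨hi1, hi2⟩ := Finset.mem_Icc.mp hi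
    obtain ⟨i, rfl⟩ : ∃ j, i = j + 1 := ⟨i - 1, by omega⟩
    have hσ := N.σ_pos (i + 1) hi1 hi2
    have hlim : Tendsto (fun a => (H.homNorm N.σ (u a) / N.σ (i + 1)) ^ (i + 1)) l (𝓝 0) := by
      have := (hu.div_const (N.σ (i + 1))).pow (i + 1)
      rwa [zero_div, zero_pow (Nat.succ_ne_zero i)] at this
    refine squeeze_zero_norm (fun a => ?_) hlim
    have h2 := N.le_homNorm (u a) ⟨i, hi2⟩
    simp only at h2
    have h3 : ‖H.proj (i + 1) (u a)‖ ^ (1 / ((i : ℝ) + 1)) ≤ H.homNorm N.σ (u a) / N.σ (i + 1) := by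
      rw [le_div_iff₀ hσ]
      linarith
    have h4 : (‖H.proj (i + 1) (u a)‖ ^ (1 / ((i : ℝ) + 1))) ^ (i + 1) =
        ‖H.proj (i + 1) (u a)‖ := by
      rw [one_div]
      exact_mod_cast Real.rpow_inv_natCast_pow (norm_nonneg _) (Nat.succ_ne_zero i)
    rw [← h4]
    exact pow_le_pow_left₀ (by positivity) h3 _
  have h2 := tendsto_finsetSum _ h1
  simpa [sum_proj] using h2

theorem dist_eq (x y : M) : N.dist x y = H.homNorm N.σ (H.mul (-x) y) := rfl

theorem dist_nonneg' (x y : M) : 0 ≤ N.dist x y := N.homNorm_nonneg _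

theorem dist_mul_left (z x y : M) : N.dist (H.mul z x) (H.mul z y) = N.dist x y := by
  rw [dist_eq, dist_eq, neg_mul', mul_assoc', neg_mul_cancel_left]

theorem dist_comm' (x y : M) : N.dist x y = N.dist y x := by
  rw [dist_eq, dist_eq, ← N.homNorm_neg, neg_mul', neg_neg]

theorem dist_triangle' (x y z : M) : N.dist x z ≤ N.dist x y + N.dist y z := by
  have h := N.homNorm_mul_le (H.mul (-x) y) (H.mul (-y) z)
  rwa [mul_assoc', mul_neg_cancel_left] at h

theorem dist_dil {r : ℝ} (hr : 0 < r) (x y : M) :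
    N.dist (H.dil r x) (H.dil r y) = r * N.dist x y := by
  rw [dist_eq, dist_eq, ← dil_neg, ← dil_mul, N.homNorm_dil hr]

variable [CompleteSpace M]

/-- Right translations are continuous for the left invariant distance. -/
theorem exists_dist_mul_right_lt (w v : M) {ε : ℝ} (hε : 0 < ε) :
    ∃ δ > 0, ∀ a, N.dist a w < δ → N.dist (H.mul a v) (H.mul w v) < ε := by
  have h1 : Tendsto (fun u => H.homNorm N.σ (H.mul (-v) (H.mul u v)))
      (comap (H.homNorm N.σ) (𝓝 0)) (𝓝 0) := by
    refine N.tendsto_homNorm_zero.comp ?_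
    have hc : Continuous fun u => H.mul (-v) (H.mul u v) :=
      Continuous.homMul H continuous_const (Continuous.homMul H continuous_id continuous_const)
    have := hc.tendsto 0
    rw [zero_mul', neg_mul_self] at this
    exact this.comp (N.tendsto_zero_of_homNorm (u := id) tendsto_comap)
  have h2 := h1.eventually (gt_mem_nhds hε)
  rw [(Metric.nhds_basis_ball.comap _).eventually_iff] at h2
  obtain ⟨δ, hδ, h⟩ := h2
  refine ⟨δ, hδ, fun a ha => ?_⟩
  have := h (show H.mul (-a) w ∈ H.homNorm N.σ ⁻¹' Metric.ball 0 δ by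
    rw [Set.mem_preimage, Metric.mem_ball, Real.dist_eq, sub_zero,
      abs_of_nonneg (N.homNorm_nonneg _)]
    exact ha)
  rwa [dist_eq, neg_mul', mul_assoc', ← mul_assoc' H (-a) w v]

/-- The distance to a point is continuous for the norm topology. -/
theorem tendsto_dist_zero (x : M) : Tendsto (fun y => N.dist x y) (𝓝 x) (𝓝 0) := by
  refine N.tendsto_homNorm_zero.comp ?_
  have := (Continuous.homMul H (continuous_const (y := -x)) continuous_id).tendsto x
  simpa [neg_mul_self, inv] using this

omit [CompleteSpace M] in
/-- Convergence for the homogeneous distance implies convergence in norm. -/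
theorem tendsto_of_dist {α : Type*} {l : Filter α} {u : α → M} {x : M}
    (hu : Tendsto (fun a => N.dist x (u a)) l (𝓝 0)) : Tendsto u l (𝓝 x) := by
  have h1 := N.tendsto_zero_of_homNorm hu
  have h2 := ((Continuous.homMul H (continuous_const (y := x)) continuous_id).tendsto 0).comp h1
  simpa [Function.comp_def, mul_zero', inv, mul_neg_cancel_left] using h2

end HomogeneousNorm

section Lipschitz

variable {E M : Type*} [NormedAddCommGroup E] [NormedSpace ℝ E] [FiniteDimensional ℝ E]
  {G : BanachHomogeneousGroup E} {D : G.HomogeneousDistance}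
  [NormedAddCommGroup M] [NormedSpace ℝ M] {H : BanachHomogeneousGroup M}
  {N : H.HomogeneousNorm} {A : Set E} {f : E → M}

theorem IsLipschitzOn.continuousOn (hG : G.IsStratified) (hf : IsLipschitzOn D N A f) :
    ContinuousOn f A := by
  obtain ⟨K, hK⟩ := hf
  intro x hx
  refine N.tendsto_of_dist ?_
  have h1 : Tendsto (fun y => K * D.d x y) (𝓝[A] x) (𝓝 0) := by
    have := ((Continuous.homogeneousDistance D hG (continuous_const (y := x))
      continuous_id).const_mul K).tendsto x
    simp only [id, (D.eq_zero_iff x x).2 rfl, mul_zero] at this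
    exact this.mono_left nhdsWithin_le_nhds
  refine squeeze_zero' (Eventually.of_forall fun _ => N.dist_nonneg' _ _) ?_ h1
  filter_upwards [self_mem_nhdsWithin] with y hy
  exact hK x hx y hy

/-- The rescaled increments of a Lipschitz map form a separable set. -/
theorem isSeparable_increments [CompleteSpace M] (hG : G.IsStratified)
    (hf : IsLipschitzOn D N A f) :
    TopologicalSpace.IsSeparable
      (⋃ n : ℕ, (fun p : E × E => H.dil (n + 1) (H.mul (-f p.1) (f p.2))) '' (A ×ˢ A)) := by
  have hfc := hf.continuousOn hG
  refine TopologicalSpace.IsSeparable.iUnion fun n => ContinuousOn.isSeparable_image ?_ ?_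
  · have h1 : ContinuousOn (fun p : E × E => f p.1) (A ×ˢ A) :=
      hfc.comp continuousOn_fst fun p hp => hp.1
    have h2 : ContinuousOn (fun p : E × E => f p.2) (A ×ˢ A) :=
      hfc.comp continuousOn_snd fun p hp => hp.2
    have h3 : Continuous fun q : M × M => H.dil ((n : ℝ) + 1) (H.mul (-q.1) q.2) :=
      Continuous.homDil H (continuous_const (y := (n : ℝ) + 1))
        (Continuous.homMul H (u := fun q : M × M => -q.1) continuous_fst.neg continuous_snd)
    have h4 := h3.comp_continuousOn (h1.prodMk h2)
    simpa only [Function.comp_def] using h4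
  · have : ProperSpace E := FiniteDimensional.proper ℝ E
    exact TopologicalSpace.IsSeparable.of_separableSpace _

end Lipschitz

end BanachHomogeneousGroup

/-! ### Porosity -/

namespace BanachHomogeneousGroup

section Porosity

variable {E : Type*} [NormedAddCommGroup E] [NormedSpace ℝ E] {G : BanachHomogeneousGroup E}
  (D : G.HomogeneousDistance)

/-- The points at which `S` is porous with constant `c`. -/
def porosityPoints (S : Set E) (c : ℝ) : Set E :=
  {x | x ∈ S ∧ ∃ u : ℕ → E, (∀ n, u n ≠ x) ∧ Tendsto (fun n => D.d x (u n)) atTop (𝓝 0) ∧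
    ∀ n, D.ball (u n) (c * D.d x (u n)) ∩ S = ∅}

theorem isPorous_porosityPoints (S : Set E) {c : ℝ} (hc : 0 < c) :
    IsPorous D (porosityPoints D S c) := by
  refine ⟨c, hc, fun x hx => ?_⟩
  obtain ⟨u, hux, hu, hball⟩ := hx.2
  refine ⟨u, hux, hu, fun n => ?_⟩
  rw [← Set.subset_empty_iff, ← hball n]
  exact Set.inter_subset_inter_right _ fun y hy => hy.1

theorem exists_near_of_notMem_porosityPoints {S : Set E} {c : ℝ} {x : E} (hx : x ∈ S)
    (hP : x ∉ porosityPoints D S c) :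
    ∃ r > 0, ∀ y, y ≠ x → D.d x y < r → ∃ z ∈ S, D.d y z < c * D.d x y := by
  by_contra! hcon
  choose u hux hud hu using fun n : ℕ => hcon (1 / ((n : ℝ) + 1)) Nat.one_div_pos_of_nat
  refine hP ⟨hx, u, hux, ?_, fun n => ?_⟩
  · exact squeeze_zero (fun n => D.d_nonneg _ _) (fun n => (hud n).le)
      tendsto_one_div_add_atTop_nhds_zero_nat
  · rw [Set.eq_empty_iff_forall_notMem]
    rintro z ⟨hz, hzS⟩
    exact absurd hz (not_lt.2 (hu n z hzS))

end Porosity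

end BanachHomogeneousGroup

/-! ### Directional derivatives -/

namespace BanachHomogeneousGroup

section DirDeriv

variable {E M : Type*} [NormedAddCommGroup E] [NormedSpace ℝ E]
  {G : BanachHomogeneousGroup E} {D : G.HomogeneousDistance}
  [NormedAddCommGroup M] [NormedSpace ℝ M] {H : BanachHomogeneousGroup M}
  {N : H.HomogeneousNorm} {A : Set E} {f : E → M} {x ζ η : E} {w v : M} {K : ℝ}

variable (G H f) in
/-- The rescaled increment `δ_{1/t} (f(x)⁻¹ f(x q))`. -/
noncomputable def increment (x : E) (t : ℝ) (q : E) : M :=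
  H.dil (1 / t) (H.mul (-f x) (f (G.mul x q)))

theorem dist_increment_le (hK : ∀ x ∈ A, ∀ y ∈ A, N.dist (f x) (f y) ≤ K * D.d x y)
    {t : ℝ} (ht : 0 < t) {p q : E} (hp : G.mul x p ∈ A) (hq : G.mul x q ∈ A) :
    N.dist (increment G H f x t p) (increment G H f x t q) ≤ K * (D.d p q / t) := by
  have h := hK _ hp _ hq
  rw [D.mul_left] at h
  rw [increment, increment, N.dist_dil (by positivity), N.dist_mul_left, one_div_mul_eq_div,
    ← mul_div_assoc]
  gcongr

/-- The increment along a composite is the product of the successive increments. -/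
theorem increment_eq_mul (x z : E) (t : ℝ) (p : E) :
    increment G H f x t p = H.mul (increment G H f x t (G.mul (-x) z))
      (increment G H f z t (G.mul (-z) (G.mul x p))) := by
  rw [increment, increment, increment, ← dil_mul, G.mul_neg_cancel_left, G.mul_neg_cancel_left,
    mul_assoc', mul_neg_cancel_left]

theorem approximates_comp_mul {p : ℝ → E} (hp : Approximates D A x ζ p) {a : ℝ} (ha : 0 < a) :
    Approximates D A x (G.dil a ζ) fun t => p (a * t) := by
  refine ⟨fun t ht => hp.1 _ (mul_pos ha ht), ?_⟩
  have h2 := (hp.2.comp (tendsto_const_mul_nhdsGT_zero ha)).const_mul a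
  rw [mul_zero] at h2
  refine h2.congr' ?_
  filter_upwards [self_mem_nhdsWithin] with t ht
  have ht : t ≠ 0 := (show 0 < t from ht).ne'
  rw [Function.comp_apply, dil_dil, mul_comm t a]
  field_simp

/-- Directional derivatives are positively homogeneous. -/
theorem HasDirDeriv.dil (h : HasDirDeriv D N A f x ζ w) {a : ℝ} (ha : 0 < a) :
    HasDirDeriv D N A f x (G.dil a ζ) (H.dil a w) := by
  obtain ⟨hx, ⟨p, hp⟩, hlim⟩ := h
  refine ⟨hx, ⟨_, approximates_comp_mul hp ha⟩, fun q hq => ?_⟩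
  have hq' := approximates_comp_mul hq (inv_pos.2 ha)
  rw [dil_dil, inv_mul_cancel₀ ha.ne', dil_one] at hq'
  have h2 := ((hlim _ hq').comp (tendsto_const_mul_nhdsGT_zero ha)).const_mul a
  rw [mul_zero] at h2
  refine h2.congr' ?_
  filter_upwards [self_mem_nhdsWithin] with t ht
  have ht : 0 < t := ht
  rw [Function.comp_apply, ← N.dist_dil ha, dil_dil, inv_mul_cancel_left₀ ha.ne',
    show a * (1 / (a * t)) = 1 / t by field_simp]

/-- The directional derivative in the direction `0` can only be `0`. -/
theorem HasDirDeriv.eq_zero (h : HasDirDeriv D N A f x 0 w) : w = 0 := by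
  obtain ⟨hx, -, hlim⟩ := h
  have h1 := hlim (fun _ => 0) ⟨fun t _ => by rwa [mul_zero'], by
    simp [dil_zero, (D.eq_zero_iff (0 : E) 0).2 rfl]⟩
  simp only [mul_zero', inv, neg_mul_self, dil_zero] at h1
  have h2 := N.tendsto_of_dist (u := fun _ : ℝ => w) h1
  exact tendsto_nhds_unique tendsto_const_nhds h2

variable (D N A f) in
/-- The points `x` of `A` at which `f` has, up to an error proportional to `ε` and at all scales
`s < r`, the increment `v` in the direction `η`. -/
def stableSet (η : E) (v : M) (ε L r : ℝ) : Set E :=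
  {x | x ∈ A ∧ ∀ s, 0 < s → s < r → ∀ q, G.mul x q ∈ A → D.d q (G.dil s η) ≤ ε * s →
    N.dist (increment G H f x s q) v ≤ L * ε}

theorem eventually_nhdsGT_exists_nat {p : ℝ → Prop} (h : ∀ᶠ t in 𝓝[>] (0 : ℝ), p t) :
    ∃ n : ℕ, ∀ t, 0 < t → t < 1 / ((n : ℝ) + 1) → p t := by
  obtain ⟨r, hr, hp⟩ := mem_nhdsGT_iff_exists_Ioo_subset.1 h
  obtain ⟨n, hn⟩ := exists_nat_one_div_lt (show (0 : ℝ) < r from hr)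
  exact ⟨n, fun t ht0 htn => hp ⟨ht0, htn.trans hn⟩⟩

theorem HasDirDeriv.exists_mem_stableSet
    (hK : ∀ x ∈ A, ∀ y ∈ A, N.dist (f x) (f y) ≤ K * D.d x y) (hK0 : 0 ≤ K)
    (h : HasDirDeriv D N A f x η v) {ε : ℝ} (hε : 0 < ε) {η' : E} {v' : M}
    (hη : D.d η η' ≤ ε) (hv : N.dist v v' ≤ ε) :
    ∃ n : ℕ, x ∈ stableSet D N A f η' v' ε (3 * K + 2) (1 / ((n : ℝ) + 1)) := by
  obtain ⟨hx, ⟨p, hp⟩, hlim⟩ := h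
  obtain ⟨n, hn⟩ := eventually_nhdsGT_exists_nat
    ((hp.2.eventually (gt_mem_nhds hε)).and ((hlim p hp).eventually (gt_mem_nhds hε)))
  refine ⟨n, hx, fun s hs hsn q hq hqd => ?_⟩
  obtain ⟨h1, h2⟩ := hn s hs hsn
  rw [div_lt_iff₀ hs] at h1
  have h3 : D.d q (p s) / s ≤ 3 * ε := by
    rw [div_le_iff₀ hs]
    have t1 := D.triangle q (G.dil s η') (p s)
    have t2 := D.triangle (G.dil s η') (G.dil s η) (p s)
    rw [D.dil s hs, D.symm η' η, D.symm (G.dil s η) (p s)] at t2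
    have t3 : s * D.d η η' ≤ s * ε := by gcongr
    linarith
  have h4 := dist_increment_le (H := H) hK hs hq (hp.1 s hs)
  have h5 := N.dist_triangle' (increment G H f x s q) (increment G H f x s (p s)) v'
  have h6 := N.dist_triangle' (increment G H f x s (p s)) v v'
  have h7 : N.dist (increment G H f x s (p s)) v < ε := h2
  have h8 : K * (D.d q (p s) / s) ≤ K * (3 * ε) := by gcongr
  linarith

/-- Directional derivatives are limits of rescaled increments along `t = 1 / (n + 1)`. -/
theorem HasDirDeriv.exists_increment_near (h : HasDirDeriv D N A f x η v) {ε : ℝ} (hε : 0 < ε) :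
    ∃ n : ℕ, ∃ y ∈ A, N.dist (H.dil ((n : ℝ) + 1) (H.mul (-f x) (f y))) v < ε := by
  obtain ⟨hx, ⟨p, hp⟩, hlim⟩ := h
  obtain ⟨n, hn⟩ := eventually_nhdsGT_exists_nat ((hlim p hp).eventually (gt_mem_nhds hε))
  have h1 := hn (1 / ((n + 1 : ℕ) + 1)) (by positivity) (by
    push_cast
    gcongr
    linarith)
  rw [one_div_one_div] at h1
  exact ⟨n + 1, _, hp.1 _ (by positivity), h1⟩

/-- The additivity of directional derivatives at points where suitable stable sets are not
porous.  For small `t`, some point `z` of the stable set is close to `x δ_t ζ` relative to `t`; the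
increment of `f` from `x` to `z` is close to `δ_t w`, and the increment from `z` to
`x p_t ≈ z δ_t η` is close to `δ_t v` because `z` is in the stable set. -/
theorem HasDirDeriv.mul [FiniteDimensional ℝ E] [CompleteSpace M] (hG : G.IsStratified)
    (hK : ∀ x ∈ A, ∀ y ∈ A, N.dist (f x) (f y) ≤ K * D.d x y) (hK0 : 0 ≤ K)
    (hζ : HasDirDeriv D N A f x ζ w) (hη : HasDirDeriv D N A f x η v)
    (happ : ∃ p, Approximates D A x (G.mul ζ η) p)
    {ηs : ℕ → E} {vs : ℕ → M} (hηs : ∀ ε > 0, ∃ i, D.d η (ηs i) ≤ ε)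
    (hvs : ∀ ε > 0, ∃ j, N.dist v (vs j) ≤ ε)
    (hx : ∀ i j k n m : ℕ, x ∉ porosityPoints D (stableSet D N A f (ηs i) (vs j)
      (1 / ((k : ℝ) + 1)) (3 * K + 2) (1 / ((n : ℝ) + 1))) (1 / ((m : ℝ) + 1))) :
    HasDirDeriv D N A f x (G.mul ζ η) (H.mul w v) := by
  rcases eq_or_ne ζ 0 with rfl | hζ0
  · rwa [hζ.eq_zero, zero_mul', zero_mul']
  refine ⟨hζ.1, happ, fun p hp => ?_⟩
  have hgζ : 0 < D.gauge ζ := D.gauge_pos hζ0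
  rw [Metric.tendsto_nhds]
  intro ε₀ hε₀
  obtain ⟨ε₁, hε₁, hmulr⟩ := N.exists_dist_mul_right_lt w v (half_pos hε₀)
  obtain ⟨k, hk⟩ := exists_nat_one_div_lt (show 0 < ε₀ / 2 / (3 * K + 3) by positivity)
  set ε : ℝ := 1 / ((k : ℝ) + 1) with hε
  have hε0 : 0 < ε := by positivity
  rw [lt_div_iff₀ (by positivity)] at hk
  obtain ⟨i, hi⟩ := hηs (ε / 3) (by positivity)
  obtain ⟨j, hj⟩ := hvs ε hε0
  obtain ⟨n, hn⟩ := hη.exists_mem_stableSet hK hK0 hε0 (hi.trans (by linarith)) hj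
  -- right translation by `η` moves `η` little if the translating element is small
  obtain ⟨δ, hδ, hδη⟩ : ∃ δ > 0, ∀ u, D.gauge u < δ → D.d η (G.mul u η) < ε / 3 := by
    have hc : Continuous fun u => D.d η (G.mul u η) :=
      Continuous.homogeneousDistance D hG continuous_const
        (Continuous.homMul G continuous_id continuous_const)
    have h0 := hc.tendsto 0
    rw [zero_mul', (D.eq_zero_iff η η).2 rfl] at h0
    obtain ⟨r, hr, h1⟩ := Metric.eventually_nhds_iff.1
      (h0.eventually (gt_mem_nhds (show 0 < ε / 3 by positivity)))
    obtain ⟨δ, hδ, h2⟩ := D.exists_norm_lt hG hr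
    exact ⟨δ, hδ, fun u hu => h1 (by simpa using h2 u hu)⟩
  obtain ⟨m, hm⟩ := exists_nat_one_div_lt
    (show 0 < min δ (ε₁ / 2 / (2 * K + 1)) / D.gauge ζ by positivity)
  set c : ℝ := 1 / ((m : ℝ) + 1) with hc
  have hc0 : 0 < c := by positivity
  rw [lt_div_iff₀ hgζ, lt_min_iff, lt_div_iff₀ (by positivity)] at hm
  obtain ⟨hm1, hm2⟩ := hm
  obtain ⟨r, hr, hnear⟩ := exists_near_of_notMem_porosityPoints D hn (hx i j k n m)
  obtain ⟨-, ⟨p₀, hp₀⟩, hlim⟩ := hζ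
  have hcζ : 0 < c * D.gauge ζ := by positivity
  have e1 : ∀ᶠ t in 𝓝[>] (0 : ℝ), t < 1 / ((n : ℝ) + 1) :=
    nhdsWithin_le_nhds (gt_mem_nhds (by positivity))
  have e2 : ∀ᶠ t in 𝓝[>] (0 : ℝ), t < r / D.gauge ζ :=
    nhdsWithin_le_nhds (gt_mem_nhds (by positivity))
  filter_upwards [e1, e2, hp₀.2.eventually (gt_mem_nhds hcζ),
    (hlim p₀ hp₀).eventually (gt_mem_nhds (half_pos hε₁)),
    hp.2.eventually (gt_mem_nhds (show 0 < ε / 3 by positivity)),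
    self_mem_nhdsWithin] with t h1 h2 h3 h4 h5 ht
  have ht : 0 < t := ht
  have h4 : N.dist (increment G H f x t (p₀ t)) w < ε₁ / 2 := h4
  rw [lt_div_iff₀ hgζ] at h2
  rw [div_lt_iff₀ ht] at h3 h5
  set y := G.mul x (G.dil t ζ) with hy
  have hdxy : D.d x y = t * D.gauge ζ := by rw [hy, D.d_mul_right, D.gauge_dil ht]
  have hyx : y ≠ x := by
    intro h
    rw [h, (D.eq_zero_iff x x).2 rfl] at hdxy
    exact absurd hdxy (by positivity)
  obtain ⟨z, ⟨hzA, hz⟩, hyz⟩ := hnear y hyx (by rwa [hdxy])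
  rw [hdxy] at hyz
  -- the increment from `x` to `z`
  have ha : N.dist (increment G H f x t (G.mul (-x) z)) w < ε₁ := by
    have hzA' : G.mul x (G.mul (-x) z) ∈ A := by rwa [mul_neg_cancel_left]
    have t1 := dist_increment_le (H := H) hK ht hzA' (hp₀.1 t ht)
    have t2 := N.dist_triangle' (increment G H f x t (G.mul (-x) z))
      (increment G H f x t (p₀ t)) w
    have t3 : D.d (G.mul (-x) z) (p₀ t) / t ≤ 2 * (c * D.gauge ζ) := by
      rw [div_le_iff₀ ht]
      have s1 := D.triangle (G.mul (-x) z) (G.dil t ζ) (p₀ t)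
      have s2 : D.d (G.mul (-x) z) (G.dil t ζ) = D.d y z := by
        rw [← D.mul_left x, mul_neg_cancel_left, ← hy, D.symm]
      rw [s2, D.symm (G.dil t ζ) (p₀ t)] at s1
      linarith
    have t4 : K * (D.d (G.mul (-x) z) (p₀ t) / t) ≤ K * (2 * (c * D.gauge ζ)) := by gcongr
    linarith
  -- the increment from `z` to `x p_t`
  have hb : N.dist (increment G H f z t (G.mul (-z) (G.mul x (p t)))) (vs j) ≤
      (3 * K + 2) * ε := by
    refine hz t ht h1 _ (by rw [mul_neg_cancel_left]; exact hp.1 t ht) ?_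
    rw [← D.mul_left z, mul_neg_cancel_left]
    have s1 := D.triangle (G.mul x (p t)) (G.mul y (G.dil t η)) (G.mul z (G.dil t (ηs i)))
    have s2 := D.triangle (G.mul y (G.dil t η)) (G.mul z (G.dil t η)) (G.mul z (G.dil t (ηs i)))
    rw [D.mul_left z, D.dil t ht] at s2
    have s3 : D.d (G.mul x (p t)) (G.mul y (G.dil t η)) = D.d (p t) (G.dil t (G.mul ζ η)) := by
      rw [hy, mul_assoc', ← dil_mul, D.mul_left]
    have s4 : D.d (G.mul y (G.dil t η)) (G.mul z (G.dil t η)) ≤ t * (ε / 3) := by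
      set u := G.dil t⁻¹ (G.mul (-y) z) with hu
      have hzu : z = G.mul y (G.dil t u) := by
        rw [hu, dil_dil, mul_inv_cancel₀ ht.ne', dil_one, mul_neg_cancel_left]
      have hug : D.gauge u < δ := by
        rw [hu, D.gauge_dil (inv_pos.2 ht), ← D.d_eq_gauge, inv_mul_lt_iff₀ ht]
        have := mul_lt_mul_of_pos_left hm1 ht
        linarith
      have heq : G.mul z (G.dil t η) = G.mul y (G.dil t (G.mul u η)) := by
        rw [hzu, mul_assoc', dil_mul]
      rw [heq, D.mul_left, D.dil t ht]
      exact mul_le_mul_of_nonneg_left (hδη u hug).le ht.le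
    have s5 : t * D.d η (ηs i) ≤ t * (ε / 3) := by gcongr
    linarith
  rw [Real.dist_eq, sub_zero, abs_of_nonneg (N.dist_nonneg' _ _)]
  change N.dist (increment G H f x t (p t)) _ < _
  rw [increment_eq_mul x z]
  set a := increment G H f x t (G.mul (-x) z)
  set b := increment G H f z t (G.mul (-z) (G.mul x (p t)))
  have f1 := N.dist_triangle' (H.mul a b) (H.mul a v) (H.mul w v)
  rw [N.dist_mul_left] at f1
  have f2 := hmulr a ha
  have f3 := N.dist_triangle' b (vs j) v
  rw [N.dist_comm' (vs j) v] at f3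
  linarith

end DirDeriv

end BanachHomogeneousGroup

theorem mainTheorem1
    {E M : Type*}
    [NormedAddCommGroup E] [NormedSpace ℝ E] [MeasurableSpace E] [BorelSpace E]
    [NormedAddCommGroup M] [NormedSpace ℝ M] [CompleteSpace M]
    (G : BanachHomogeneousGroup E) (hG : G.IsStratified)
    (D : G.HomogeneousDistance) (μ : Measure E) (hμ : G.IsHaar μ)
    (H : BanachHomogeneousGroup M) (N : H.HomogeneousNorm)
    (A : Set E) (hA : NullMeasurableSet A μ)
    (f : E → M) (hf : BanachHomogeneousGroup.IsLipschitzOn D N A f) :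
    ∃ P : Set E, BanachHomogeneousGroup.IsSigmaPorous D P ∧
      ∀ x ∈ A, BanachHomogeneousGroup.IsDensityPoint D μ A x → x ∉ P →
        ∀ (ζ η : E) (w v : M),
          BanachHomogeneousGroup.HasDirDeriv D N A f x ζ w →
          BanachHomogeneousGroup.HasDirDeriv D N A f x η v →
          ∀ a b : ℝ, 0 < a → 0 < b →
            BanachHomogeneousGroup.HasDirDeriv D N A f x
              (G.mul (G.dil a ζ) (G.dil b η)) (H.mul (H.dil a w) (H.dil b v)) := by
  have : FiniteDimensional ℝ E := hG.finiteDimensional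
  have : ProperSpace E := FiniteDimensional.proper ℝ E
  obtain ⟨K, hK0, hK⟩ : ∃ K : ℝ, 0 ≤ K ∧
      ∀ x ∈ A, ∀ y ∈ A, N.dist (f x) (f y) ≤ K * D.d x y := by
    obtain ⟨K, hK⟩ := hf
    refine ⟨|K|, abs_nonneg K, fun x hx y hy => (hK x hx y hy).trans ?_⟩
    exact mul_le_mul_of_nonneg_right (le_abs_self K) (D.d_nonneg x y)
  -- countably many directions and values suffice
  obtain ⟨S, hS, hTS⟩ := BanachHomogeneousGroup.isSeparable_increments hG hf
  obtain ⟨vs, hvs⟩ := (hS.insert 0).exists_eq_range (Set.insert_nonempty _ _)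
  set ηs : ℕ → E := TopologicalSpace.denseSeq E
  set F : ℕ × ℕ × ℕ × ℕ × ℕ → Set E := fun l => BanachHomogeneousGroup.porosityPoints D
    (BanachHomogeneousGroup.stableSet D N A f (ηs l.1) (vs l.2.1) (1 / ((l.2.2.1 : ℝ) + 1))
      (3 * K + 2) (1 / ((l.2.2.2.1 : ℝ) + 1))) (1 / ((l.2.2.2.2 : ℝ) + 1)) with hF
  refine ⟨⋃ l, F l, ⟨fun i => F ((Denumerable.eqv _).symm i), fun i => ?_, ?_⟩, ?_⟩
  · exact BanachHomogeneousGroup.isPorous_porosityPoints D _ (by positivity)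
  · exact ((Denumerable.eqv _).symm.surjective.iUnion_comp F).symm
  intro x hxA hx hxP ζ η w v hζ hη a b ha hb
  refine (hζ.dil ha).mul hG hK hK0 (hη.dil hb) (D.exists_approximates hG hμ hxA hx _)
    (ηs := ηs) (vs := vs) ?_ ?_ ?_
  · intro ε hε
    have hc : Continuous fun y => D.d (G.dil b η) y :=
      Continuous.homogeneousDistance D hG continuous_const continuous_id
    obtain ⟨y, hy, i, rfl⟩ := (TopologicalSpace.denseRange_denseSeq E).inter_open_nonempty _
      (isOpen_lt hc continuous_const) ⟨G.dil b η, by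
        change D.d (G.dil b η) (G.dil b η) < ε
        rwa [(D.eq_zero_iff _ _).2 rfl]⟩
    exact ⟨i, le_of_lt (show D.d (G.dil b η) (ηs i) < ε from hy)⟩
  · intro ε hε
    obtain ⟨n, y, hy, hn⟩ := (hη.dil hb).exists_increment_near (half_pos hε)
    set τ := H.dil ((n : ℝ) + 1) (H.mul (-f x) (f y)) with hτ
    have hτS : τ ∈ closure S := hTS (Set.mem_iUnion.2 ⟨n, (x, y), ⟨hxA, hy⟩, rfl⟩)
    obtain ⟨v', hv'S, hv'⟩ := (mem_closure_iff_frequently.1 hτS).and_eventually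
      ((N.tendsto_dist_zero τ).eventually (gt_mem_nhds (half_pos hε))) |>.exists
    obtain ⟨j, rfl⟩ : v' ∈ Set.range vs := hvs ▸ Set.mem_insert_of_mem _ hv'S
    refine ⟨j, ?_⟩
    have := N.dist_triangle' (H.dil b v) τ (vs j)
    rw [N.dist_comm' _ τ] at this
    linarith
  · intro i j k n m hmem
    exact hxP (Set.mem_iUnion.2 ⟨(i, j, k, n, m), hmem⟩)
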